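/- Let $f\in\mathbb{C}[z_1,z_2]$ be one of the normal forms of the simple plane curve singularities: $z_1^{k+1}+z_2^2$ (type $A_k$, $k\ge 1$), $z_1^2z_2+z_2^{k-1}$ (type $D_k$, $k\ge 4$), $z_1^3+z_2^4$ (type $E_6$), $z_1^3+z_1z_2^3$ (type $E_7$), $z_1^3+z_2^5$ (type $E_8$), where $k=6,7,8$ for the types $E_6,E_7,E_8$. Let $A=\mathbb{C}[z_1,z_2]/\langle f\rangle$ and let $\nabla f\in A^2$ be the class of the gradient $(\partial f/\partial z_1,\partial f/\partial z_2)$. For $j\in\mathbb{N}$ let $HH^j$ (resp. $HH_j$) be the Hochschild cohomology (resp. homology) of the $\mathbb{C}$-algebra $A$ in degree $j$, that is, the cohomology of the complex of $\mathbb{C}$-multilinear cochains $A^j\to A$ (resp. the homology of the complex of chains $A\otimes_{\mathbb{C}} A^{\otimes j}$) with the usual Hochschild differential; since $A$ is commutative, these are $A$-modules. Then: 1. $HH^0\cong A$ and $HH_0\cong A$ as $A$-modules; 2. $HH^1\cong A\oplus\mathbb{C}^k$ as complex vector spaces, by an isomorphism whose restriction to the summand $A$ is $A$-linear; 3. $HH_1\cong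 A^2/(A\nabla f)$ as $A$-modules; 4. for all $j\ge 2$, $HH^j\cong\mathbb{C}^k$ and $HH_j\cong\mathbb{C}^k$ as complex vector spaces. -/

import Mathlib

set_option maxSynthPendingDepth 3

open scoped TensorProduct

noncomputable section

namespace Hochschild

variable {k A M : Type*} [CommRing k] [CommRing A] [Algebra k A]
  [AddCommGroup M] [Module k M]

/-- Changing one entry of a tuple changes one entry of the contracted tuple, `k`-linearly. -/
theorem exists_contractNth_update {n : ℕ} (i : Fin n) (a : Fin (n + 1) → A) (j : Fin (n + 1)) :
    ∃ (l : Fin n) (φ : A →ₗ[k] A), ∀ x : A,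
      Fin.contractNth i.castSucc (· * ·) (Function.update a j x) =
        Function.update (Fin.contractNth i.castSucc (· * ·) a) l (φ x) := by
  have key : ∀ (l : Fin n) (φ : A →ₗ[k] A) (x : A),
      (∀ m : Fin n, Fin.contractNth i.castSucc (· * ·) (Function.update a j x) m =
        if m = l then φ x else Fin.contractNth i.castSucc (· * ·) a m) →
      Fin.contractNth i.castSucc (· * ·) (Function.update a j x) =
        Function.update (Fin.contractNth i.castSucc (· * ·) a) l (φ x) := by
    intro l φ x h
    funext m
    rw [h m, Function.update_apply]
  rcases lt_trichotomy (j : ℕ) i with h | h | h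
  · refine ⟨⟨j, by omega⟩, LinearMap.id, fun x => key _ _ _ fun m => ?_⟩
    simp only [Fin.contractNth, Function.update_apply, Fin.ext_iff, Fin.val_castSucc,
      Fin.val_succ, LinearMap.id_apply]
    split_ifs <;> first | rfl | omega
  · refine ⟨i, LinearMap.mulRight k (a i.succ), fun x => key _ _ _ fun m => ?_⟩
    by_cases hm : m = i
    · subst hm
      simp [Fin.contractNth, Function.update_apply, Fin.ext_iff, h]
    · have hm' : (m : ℕ) ≠ i := fun e => hm (Fin.ext e)
      simp only [Fin.contractNth, Function.update_apply, Fin.ext_iff, Fin.val_castSucc,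
        Fin.val_succ]
      split_ifs <;> first | rfl | omega
  · by_cases h' : (j : ℕ) = i + 1
    · refine ⟨i, LinearMap.mulLeft k (a i.castSucc), fun x => key _ _ _ fun m => ?_⟩
      by_cases hm : m = i
      · subst hm
        simp [Fin.contractNth, Function.update_apply, Fin.ext_iff, h']
      · have hm' : (m : ℕ) ≠ i := fun e => hm (Fin.ext e)
        simp only [Fin.contractNth, Function.update_apply, Fin.ext_iff, Fin.val_castSucc,
          Fin.val_succ]
        split_ifs <;> first | rfl | omega
    · refine ⟨⟨j - 1, by omega⟩, LinearMap.id, fun x => key _ _ _ fun m => ?_⟩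
      simp only [Fin.contractNth, Function.update_apply, Fin.ext_iff, Fin.val_castSucc,
        Fin.val_succ, LinearMap.id_apply]
      split_ifs <;> first | rfl | omega

/-- The multilinear map `(a₀, …, aₙ) ↦ f (a₀, …, aᵢ * aᵢ₊₁, …, aₙ)`. -/
def mulFace {n : ℕ} (f : MultilinearMap k (fun _ : Fin n => A) M) (i : Fin n) :
    MultilinearMap k (fun _ : Fin (n + 1) => A) M where
  toFun a := f (Fin.contractNth i.castSucc (· * ·) a)
  map_update_add' {inst} a j x y := by
    rw [Subsingleton.elim inst (instDecidableEqFin (n + 1))]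
    obtain ⟨l, φ, h⟩ := exists_contractNth_update (k := k) i a j
    simp only [h, map_add, MultilinearMap.map_update_add]
  map_update_smul' {inst} a j c x := by
    rw [Subsingleton.elim inst (instDecidableEqFin (n + 1))]
    obtain ⟨l, φ, h⟩ := exists_contractNth_update (k := k) i a j
    simp only [h, map_smul, MultilinearMap.map_update_smul]

@[simp]
theorem mulFace_apply {n : ℕ} (f : MultilinearMap k (fun _ : Fin n => A) M) (i : Fin n)
    (a : Fin (n + 1) → A) : mulFace f i a = f (Fin.contractNth i.castSucc (· * ·) a) := rfl

variable [Module A M] [IsScalarTower k A M]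

instance isScalarTower_multilinearMap (n : ℕ) :
    IsScalarTower k A (MultilinearMap k (fun _ : Fin n => A) M) :=
  ⟨fun c a f => MultilinearMap.ext fun x => smul_assoc c a (f x)⟩

/-- The multilinear map `(a₀, …, aₙ) ↦ a₀ • f (a₁, …, aₙ)`. -/
def leftFace {n : ℕ} (f : MultilinearMap k (fun _ : Fin n => A) M) :
    MultilinearMap k (fun _ : Fin (n + 1) => A) M :=
  LinearMap.uncurryLeft
    { toFun := fun a => a • f
      map_add' := fun a b => add_smul a b f
      map_smul' := fun c a => smul_assoc c a f }

@[simp]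
theorem leftFace_apply {n : ℕ} (f : MultilinearMap k (fun _ : Fin n => A) M)
    (a : Fin (n + 1) → A) : leftFace f a = a 0 • f (Fin.tail a) := rfl

/-- The multilinear map `(a₀, …, aₙ) ↦ aₙ • f (a₀, …, aₙ₋₁)`. -/
def rightFace {n : ℕ} (f : MultilinearMap k (fun _ : Fin n => A) M) :
    MultilinearMap k (fun _ : Fin (n + 1) => A) M where
  toFun a := a (Fin.last n) • f (Fin.init a)
  map_update_add' {inst} a j x y := by
    rw [Subsingleton.elim inst (instDecidableEqFin (n + 1))]
    induction j using Fin.lastCases with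
    | last => simp [add_smul]
    | cast j => simp [Fin.init_update_castSucc, (Fin.castSucc_lt_last j).ne']
  map_update_smul' {inst} a j c x := by
    rw [Subsingleton.elim inst (instDecidableEqFin (n + 1))]
    induction j using Fin.lastCases with
    | last => simp
    | cast j =>
      simp [Fin.init_update_castSucc, (Fin.castSucc_lt_last j).ne', smul_algebra_smul_comm]

@[simp]
theorem rightFace_apply {n : ℕ} (f : MultilinearMap k (fun _ : Fin n => A) M)
    (a : Fin (n + 1) → A) : rightFace f a = a (Fin.last n) • f (Fin.init a) := rfl

variable (k A M) in
/-- The Hochschild coboundary for the commutative `k`-algebra `A` and an `A`-module `M`,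
regarded as a symmetric bimodule:
`(d f)(a₀, …, aₙ) = a₀ f(a₁, …, aₙ) + ∑_{i < n} (-1)^(i+1) f(a₀, …, aᵢ aᵢ₊₁, …, aₙ)
  + (-1)^(n+1) f(a₀, …, aₙ₋₁) aₙ`. -/
def coboundary (n : ℕ) :
    MultilinearMap k (fun _ : Fin n => A) M →ₗ[A]
      MultilinearMap k (fun _ : Fin (n + 1) => A) M where
  toFun f := leftFace f + ∑ i : Fin n, (-1 : ℤ) ^ ((i : ℕ) + 1) • mulFace f i
    + (-1 : ℤ) ^ (n + 1) • rightFace f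
  map_add' f g := by
    ext a
    simp [smul_add, Finset.sum_add_distrib]
    abel
  map_smul' c f := by
    ext a
    simp [smul_add, Finset.smul_sum, smul_comm _ c]

theorem coboundary_apply (n : ℕ) (f : MultilinearMap k (fun _ : Fin n => A) M)
    (a : Fin (n + 1) → A) :
    coboundary k A M n f a = a 0 • f (Fin.tail a)
      + ∑ i : Fin n, (-1 : ℤ) ^ ((i : ℕ) + 1) • f (Fin.contractNth i.castSucc (· * ·) a)
      + (-1 : ℤ) ^ (n + 1) • a (Fin.last n) • f (Fin.init a) := by
  simp [coboundary]

variable (k A)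

/-- Hochschild `n`-cochains of `A`: `k`-multilinear maps `Aⁿ → A`, that is, `k`-linear maps
`A^{⊗ n} → A`. -/
abbrev Cochain (n : ℕ) : Type _ := MultilinearMap k (fun _ : Fin n => A) A

/-- The Hochschild cocycles of degree `n`. -/
def cocycles (n : ℕ) : Submodule A (Cochain k A n) := LinearMap.ker (coboundary k A A n)

/-- The Hochschild coboundaries of degree `n`. -/
def coboundaries : (n : ℕ) → Submodule A (Cochain k A n)
  | 0 => ⊥
  | n + 1 => LinearMap.range (coboundary k A A n)

/-- The Hochschild cohomology `HHⁿ(A)` of the commutative `k`-algebra `A`, with its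
`A`-module structure. -/
abbrev Cohomology (n : ℕ) : Type _ :=
  cocycles k A n ⧸ (coboundaries k A n).submoduleOf (cocycles k A n)

/-- Hochschild `n`-chains of `A`: the `A`-module `A ⊗ A^{⊗ n}`, with `A` acting on the first
factor. -/
abbrev Chain (n : ℕ) : Type _ := A ⊗[k] (⨂[k] _ : Fin n, A)

/-- The multilinear map `(a₁, …, aₙ) ↦ 1 ⊗ a₁ ⊗ ⋯ ⊗ aₙ`. -/
def tensorCochain (n : ℕ) : MultilinearMap k (fun _ : Fin n => A) (Chain k A n) :=
  (TensorProduct.mk k A (⨂[k] _ : Fin n, A) 1).compMultilinearMap (PiTensorProduct.tprod k)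

/-- The Hochschild boundary `A ⊗ A^{⊗ (n + 1)} → A ⊗ A^{⊗ n}`; see `boundary_tmul_tprod` for
its values on pure tensors. -/
def boundary (n : ℕ) : Chain k A (n + 1) →ₗ[A] Chain k A n :=
  LinearMap.liftBaseChange A
    (PiTensorProduct.lift (coboundary k A (Chain k A n) n (tensorCochain k A n)))

/-- The value of the Hochschild boundary on `a₀ ⊗ a₁ ⊗ ⋯ ⊗ aₙ₊₁`; the entry `aᵢ₊₁` is `a i`. -/
theorem boundary_tmul_tprod (n : ℕ) (a₀ : A) (a : Fin (n + 1) → A) :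
    boundary k A n (a₀ ⊗ₜ[k] PiTensorProduct.tprod k a) =
      (a₀ * a 0) ⊗ₜ[k] PiTensorProduct.tprod k (Fin.tail a)
      + ∑ i : Fin n, (-1 : ℤ) ^ ((i : ℕ) + 1) •
          a₀ ⊗ₜ[k] PiTensorProduct.tprod k (Fin.contractNth i.castSucc (· * ·) a)
      + (-1 : ℤ) ^ (n + 1) •
          (a (Fin.last n) * a₀) ⊗ₜ[k] PiTensorProduct.tprod k (Fin.init a) := by
  simp [boundary, coboundary_apply, tensorCochain, Finset.smul_sum,
    TensorProduct.smul_tmul', mul_comm a₀, mul_assoc]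

/-- The Hochschild cycles of degree `n`; in degree `0` every chain is a cycle. -/
def cycles : (n : ℕ) → Submodule A (Chain k A n)
  | 0 => ⊤
  | n + 1 => LinearMap.ker (boundary k A n)

/-- The Hochschild boundaries of degree `n`. -/
def boundaries (n : ℕ) : Submodule A (Chain k A n) := LinearMap.range (boundary k A n)

/-- The Hochschild homology `HHₙ(A)` of the commutative `k`-algebra `A`, with its `A`-module
structure. -/
abbrev Homology (n : ℕ) : Type _ :=
  cycles k A n ⧸ (boundaries k A n).submoduleOf (cycles k A n)

end Hochschild

/-- The types of the simple plane curve singularities: `A_k` (`k ≥ 1`), `D_k` (`k ≥ 4`),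
`E_6`, `E_7`, `E_8`. -/
inductive SimpleType : Type
  | A (k : ℕ) (hk : 1 ≤ k)
  | D (k : ℕ) (hk : 4 ≤ k)
  | E6
  | E7
  | E8

namespace SimpleType

open MvPolynomial

/-- The index `k` of the type. -/
def index : SimpleType → ℕ
  | A k _ => k
  | D k _ => k
  | E6 => 6
  | E7 => 7
  | E8 => 8

/-- The normal form of each type; the variables `z₁`, `z₂` are `X 0`, `X 1`. -/
def normalForm : SimpleType → MvPolynomial (Fin 2) ℂ
  | A k _ => X 0 ^ (k + 1) + X 1 ^ 2
  | D k _ => X 0 ^ 2 * X 1 + X 1 ^ (k - 1)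
  | E6 => X 0 ^ 3 + X 1 ^ 4
  | E7 => X 0 ^ 3 + X 0 * X 1 ^ 3
  | E8 => X 0 ^ 3 + X 1 ^ 5

/-- The coordinate ring `ℂ[z₁, z₂] / ⟨f⟩` of the curve. -/
abbrev CoordRing (T : SimpleType) : Type :=
  MvPolynomial (Fin 2) ℂ ⧸ Ideal.span {T.normalForm}

/-- The gradient of the normal form, as an element of `A²`. -/
def gradient (T : SimpleType) : Fin 2 → T.CoordRing :=
  fun i => Ideal.Quotient.mk _ (pderiv i T.normalForm)

end SimpleType

end

/-! Let `A` be the coordinate ring and `Aᵉ = A ⊗ A`. The bar resolution of `A` over `Aᵉ` yields the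
Hochschild chains after base change along multiplication (`boundary_chainEquiv`), and the cochains
are the `A`-dual of the chains (`cochainEquiv_coboundary`). Projective resolutions of `A` are
homotopy equivalent (`HtpyEquiv.exists_of_isResolution`), so any free resolution over `Aᵉ` may
replace the bar resolution.

A plane curve has a small one. `Aᵉ` is `A[X₀, X₁]/(F)`, with `F` the polynomial `f` read over `A`.
Since `F` vanishes at the point `x` of coordinate functions, `F = g₁ u + g₂ v` with `u, v` the
differences `Xᵢ - xᵢ`. Tate's construction takes the Koszul complex on `u, v` and adjoins a divided
power variable killing the cycle `(g₁, g₂)`. This gives ranks 1, 2, 2, ... and a complex that is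
2-periodic from degree 1 on (`exists_isResolution_curve`). Multiplication `Aᵉ → A` sends `u, v` to
`0` and `g₁, g₂` to the partial derivatives, so only the gradient survives in the differentials.
This settles degree 0 and `HH₁`.

The normal forms are quasi-homogeneous with coprime partial derivatives, so `f` is a combination of
them (`IsolatedEuler`). From degree 2 on, every group then consists of the multiples of one class, a
coordinate vector or an Euler vector, and the multiple by `r` vanishes exactly when `r` lies in the
Jacobian ideal `J`; the group is `ℂ[z₁, z₂]/J`. `HH¹` is the module of pairs orthogonal to the
gradient. Multiples of the Hamiltonian pair `(-∂f/∂z₂, ∂f/∂z₁)` form a copy of `A` in it, with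
quotient again `ℂ[z₁, z₂]/J`.

Finally `J` has the shape `(y ^ r, x y ^ s, x ^ 2 + c y ^ m)` for every type. The quotient has basis
`yⁱ` for `i < r` and `x yⁱ` for `i < s`, and `r + s` is the index (`nonempty_twoRow_equiv`,
`spec_normalForm`). -/

/-- Dependent recursive choice. -/
theorem exists_dependent_seq {α : ℕ → Type*} (Q : ∀ n, α n → Prop) (r : ∀ n, α n → α (n + 1) → Prop)
    (a : α 0) (ha : Q 0 a) (step : ∀ n x, Q n x → ∃ y, r n x y ∧ Q (n + 1) y) :
    ∃ s : ∀ n, α n, s 0 = a ∧ (∀ n, Q n (s n)) ∧ ∀ n, r n (s n) (s (n + 1)) := by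
  choose next hr hQ using step
  let s : ∀ n, {x : α n // Q n x} := fun n =>
    Nat.rec ⟨a, ha⟩ (fun n x => ⟨next n x.1 x.2, hQ n x.1 x.2⟩) n
  exact ⟨fun n => (s n).1, rfl, fun n => (s n).2, fun n => hr n _ (s n).2⟩

/-! ### Comparison of projective resolutions. -/

section Comparison

variable {S : Type*} [CommRing S]

theorem exists_lift_of_range_le {M N L : Type*} [AddCommGroup M] [AddCommGroup N] [AddCommGroup L]
    [Module S M] [Module S N] [Module S L] [Module.Projective S M] (f : M →ₗ[S] L) (g : N →ₗ[S] L)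
    (h : ∀ x, f x ∈ LinearMap.range g) : ∃ φ : M →ₗ[S] N, g ∘ₗ φ = f := by
  obtain ⟨φ, hφ⟩ := Module.projective_lifting_property g.rangeRestrict
    (f.codRestrict (LinearMap.range g) h) g.surjective_rangeRestrict
  refine ⟨φ, LinearMap.ext fun x => ?_⟩
  simpa using congrArg Subtype.val (LinearMap.congr_fun hφ x)

variable {M N : ℕ → Type*} {E : Type*} [∀ n, AddCommGroup (M n)] [∀ n, AddCommGroup (N n)]
  [∀ n, Module S (M n)] [∀ n, Module S (N n)] [AddCommGroup E] [Module S E]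

/-- The complex `(N, d)` with augmentation `ε` is a resolution of `E`. -/
structure IsResolution (d : ∀ n, N (n + 1) →ₗ[S] N n) (ε : N 0 →ₗ[S] E) : Prop where
  surjective : Function.Surjective ε
  exact_zero : Function.Exact (d 0) ε
  exact_succ : ∀ n, Function.Exact (d (n + 1)) (d n)

variable {dM : ∀ n, M (n + 1) →ₗ[S] M n} {dN : ∀ n, N (n + 1) →ₗ[S] N n}
  {εM : M 0 →ₗ[S] E} {εN : N 0 →ₗ[S] E}

theorem IsResolution.exists_chainMap [∀ n, Module.Projective S (M n)]
    (hM : IsResolution dM εM) (hN : IsResolution dN εN) :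
    ∃ φ : ∀ n, M n →ₗ[S] N n, εN ∘ₗ φ 0 = εM ∧ ∀ n, dN n ∘ₗ φ (n + 1) = φ n ∘ₗ dM n := by
  obtain ⟨φ₀, h₀⟩ := exists_lift_of_range_le εM εN fun x => hN.surjective _
  -- The invariant carried along is that `f ∘ dM` lands in the range of `dN`, which is exactly what
  -- the next lifting requires.
  obtain ⟨φ, rfl, -, hφ⟩ := exists_dependent_seq (α := fun n => M n →ₗ[S] N n)
    (fun n f => ∀ x, (f ∘ₗ dM n) x ∈ LinearMap.range (dN n))
    (fun n f g => dN n ∘ₗ g = f ∘ₗ dM n) φ₀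
    (fun x => (hN.exact_zero _).1 <| by
      have := LinearMap.congr_fun h₀ (dM 0 x)
      simpa [hM.exact_zero.apply_apply_eq_zero] using this)
    (fun n f hf => by
      obtain ⟨g, hg⟩ := exists_lift_of_range_le _ _ hf
      refine ⟨g, hg, fun x => (hN.exact_succ n _).1 ?_⟩
      have := LinearMap.congr_fun hg (dM (n + 1) x)
      simpa [(hM.exact_succ n).apply_apply_eq_zero] using this)
  exact ⟨φ, h₀, hφ⟩

theorem IsResolution.exists_homotopy [∀ n, Module.Projective S (M n)]
    (hM : IsResolution dM εM) (hN : IsResolution dN εN) (χ : ∀ n, M n →ₗ[S] N n)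
    (h₀ : εN ∘ₗ χ 0 = 0) (hχ : ∀ n, dN n ∘ₗ χ (n + 1) = χ n ∘ₗ dM n) :
    ∃ h : ∀ n, M n →ₗ[S] N (n + 1), χ 0 = dN 0 ∘ₗ h 0 ∧
      ∀ n, χ (n + 1) = dN (n + 1) ∘ₗ h (n + 1) + h n ∘ₗ dM n := by
  obtain ⟨k₀, hk₀⟩ := exists_lift_of_range_le (χ 0) (dN 0) fun x =>
    (hN.exact_zero _).1 (LinearMap.congr_fun h₀ x)
  -- The homotopy identity is needed only on the image of `dM`: it makes `χ (n + 1) - f ∘ dM` a map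
  -- into cycles, hence into boundaries by exactness.
  have key : ∀ n (f : M n →ₗ[S] N (n + 1)),
      (∀ x, dN n (f (dM n x)) = χ n (dM n x)) →
      ∀ x, (χ (n + 1) - f ∘ₗ dM n) x ∈ LinearMap.range (dN (n + 1)) := fun n f hf x => by
    refine (hN.exact_succ n _).1 ?_
    have := LinearMap.congr_fun (hχ n) x
    simp only [LinearMap.comp_apply] at this
    simp [hf, this]
  obtain ⟨h, rfl, -, hh⟩ := exists_dependent_seq (α := fun n => M n →ₗ[S] N (n + 1))
    (fun n f => ∀ x, dN n (f (dM n x)) = χ n (dM n x))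
    (fun n f g => dN (n + 1) ∘ₗ g = χ (n + 1) - f ∘ₗ dM n) k₀
    (fun x => LinearMap.congr_fun hk₀ (dM 0 x))
    (fun n f hf => by
      obtain ⟨g, hg⟩ := exists_lift_of_range_le _ _ (key n f hf)
      refine ⟨g, hg, fun x => ?_⟩
      have := LinearMap.congr_fun hg (dM (n + 1) x)
      simpa [(hM.exact_succ n).apply_apply_eq_zero] using this)
  exact ⟨h, hk₀.symm, fun n => by rw [hh n]; abel⟩

end Comparison

/-- A pair of maps that are mutually inverse up to homotopy induces an isomorphism of
subquotients. -/
noncomputable def Submodule.subquotientEquiv {A X Y : Type*} [CommRing A] [AddCommGroup X]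
    [AddCommGroup Y] [Module A X] [Module A Y] {Z B : Submodule A X} {Z' B' : Submodule A Y}
    (f : X →ₗ[A] Y) (g : Y →ₗ[A] X)
    (hfZ : ∀ x ∈ Z, f x ∈ Z') (hfB : ∀ x ∈ B, f x ∈ B')
    (hgZ : ∀ y ∈ Z', g y ∈ Z) (hgB : ∀ y ∈ B', g y ∈ B)
    (hgf : ∀ x ∈ Z, g (f x) - x ∈ B) (hfg : ∀ y ∈ Z', f (g y) - y ∈ B') :
    (Z ⧸ B.submoduleOf Z) ≃ₗ[A] (Z' ⧸ B'.submoduleOf Z') :=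
  LinearEquiv.ofLinearMap
    (Submodule.mapQ _ _ (f.restrict hfZ) fun x hx => hfB x hx)
    (Submodule.mapQ _ _ (g.restrict hgZ) fun y hy => hgB y hy)
    (by
      refine Submodule.linearMap_qext _ (LinearMap.ext fun y => ?_)
      exact (Submodule.Quotient.eq _).2 (hfg y y.2))
    (by
      refine Submodule.linearMap_qext _ (LinearMap.ext fun x => ?_)
      exact (Submodule.Quotient.eq _).2 (hgf x x.2))

/-! ### The bar resolution over the enveloping algebra. -/

namespace Hochschild

section Bar

theorem contractNth_zero_cons {A : Type*} [Mul A] {n : ℕ} (a : A) (t : Fin (n + 1) → A) :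
    Fin.contractNth (0 : Fin (n + 1)).castSucc (· * ·) (Fin.cons a t : Fin (n + 2) → A) =
      Fin.cons (a * t 0) (Fin.tail t) := by
  funext i
  refine Fin.cases ?_ (fun i => ?_) i
  · simp [Fin.contractNth]
  · simp [Fin.contractNth, Fin.tail]

theorem contractNth_succ_cons {A : Type*} [Mul A] {n : ℕ} (a : A) (t : Fin (n + 1) → A) (j : Fin n) :
    Fin.contractNth j.succ.castSucc (· * ·) (Fin.cons a t : Fin (n + 2) → A) =
      Fin.cons a (Fin.contractNth j.castSucc (· * ·) t) := by
  funext i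
  refine Fin.cases ?_ (fun i => ?_) i
  · simp [Fin.contractNth]
  · simp only [Fin.contractNth, Fin.cons_succ, Fin.val_succ, Fin.val_castSucc]
    rcases lt_trichotomy (i : ℕ) j with h | h | h
    · simp [h]
    · simp [h]
    · have h1 : ¬ ((i : ℕ) < j) := by omega
      have h2 : ¬ ((i : ℕ) = j) := by omega
      simp [h1, h2]

theorem init_cons {A : Type*} {n : ℕ} (a : A) (t : Fin (n + 1) → A) :
    Fin.init (Fin.cons a t : Fin (n + 2) → A) = Fin.cons a (Fin.init t) := by
  funext i
  refine Fin.cases ?_ (fun i => ?_) i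
  · simp [Fin.init]
  · simp [Fin.init]


variable (k A : Type*) [CommRing k] [CommRing A] [Algebra k A]

/-- The enveloping algebra `A ⊗ A`. It is a separate type because `A` is an algebra over it through
multiplication. -/
def Env : Type _ := A ⊗[k] A

noncomputable instance : CommRing (Env k A) := inferInstanceAs (CommRing (A ⊗[k] A))

noncomputable instance : Algebra k (Env k A) := inferInstanceAs (Algebra k (A ⊗[k] A))

namespace Env

/-- The left factor of the enveloping algebra. -/
noncomputable def inl : A →ₐ[k] Env k A :=
  (Algebra.TensorProduct.includeLeft : A →ₐ[k] A ⊗[k] A)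

/-- The right factor of the enveloping algebra. -/
noncomputable def inr : A →ₐ[k] Env k A :=
  (Algebra.TensorProduct.includeRight : A →ₐ[k] A ⊗[k] A)

/-- The multiplication of `A`. -/
noncomputable def mul : Env k A →ₐ[k] A :=
  (Algebra.TensorProduct.lmul' k : A ⊗[k] A →ₐ[k] A)

noncomputable instance : Algebra (Env k A) A := (mul k A).toRingHom.toAlgebra

variable {k A}

@[simp]
theorem mul_inl (a : A) : mul k A (inl k A a) = a :=
  (Algebra.TensorProduct.lmul'_apply_tmul a 1).trans (mul_one a)

@[simp]
theorem mul_inr (a : A) : mul k A (inr k A a) = a :=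
  (Algebra.TensorProduct.lmul'_apply_tmul 1 a).trans (one_mul a)

theorem algebraMap_apply (s : Env k A) : algebraMap (Env k A) A s = mul k A s := rfl

instance : IsScalarTower k (Env k A) A :=
  IsScalarTower.of_algebraMap_eq fun c => by
    rw [algebraMap_apply, AlgHom.commutes]

theorem inl_mul_inr (a a' : A) : inl k A a * inr k A a' = (a ⊗ₜ[k] a' : A ⊗[k] A) :=
  (Algebra.TensorProduct.tmul_mul_tmul a 1 1 a').trans (by rw [mul_one, one_mul])

theorem hom_ext {M : Type*} [AddCommMonoid M] [Module k M] {f g : Env k A →ₗ[k] M}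
    (h : ∀ a a', f (inl k A a * inr k A a') = g (inl k A a * inr k A a')) : f = g :=
  TensorProduct.ext' (M := A) (N := A) fun a a' => by
    rw [← inl_mul_inr]; exact h a a'

/-- The linear map on `A ⊗ A` defined by a bilinear map. -/
noncomputable def lift {M : Type*} [AddCommMonoid M] [Module k M] (f : A →ₗ[k] A →ₗ[k] M) :
    Env k A →ₗ[k] M :=
  TensorProduct.lift f

@[simp]
theorem lift_apply {M : Type*} [AddCommMonoid M] [Module k M] (f : A →ₗ[k] A →ₗ[k] M) (a a' : A) :
    lift f (inl k A a * inr k A a') = f a a' := by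
  rw [inl_mul_inr]; exact TensorProduct.lift.tmul a a'

end Env

/-- The alternating sum of two outer faces and the inner faces of a multilinear map. -/
noncomputable def faceSum {k A} [CommRing k] [CommRing A] [Algebra k A] {M : Type*}
    [AddCommGroup M] [Module k M] {n : ℕ}
    (f : MultilinearMap k (fun _ : Fin n => A) M)
    (l r : MultilinearMap k (fun _ : Fin (n + 1) => A) M) :
    MultilinearMap k (fun _ : Fin (n + 1) => A) M :=
  l + ∑ i : Fin n, (-1 : ℤ) ^ ((i : ℕ) + 1) • mulFace f i + (-1 : ℤ) ^ (n + 1) • r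

theorem faceSum_apply {k A} [CommRing k] [CommRing A] [Algebra k A] {M : Type*}
    [AddCommGroup M] [Module k M] {n : ℕ}
    (f : MultilinearMap k (fun _ : Fin n => A) M)
    (l r : MultilinearMap k (fun _ : Fin (n + 1) => A) M) (a) :
    faceSum f l r a = l a
      + ∑ i : Fin n, (-1 : ℤ) ^ ((i : ℕ) + 1) • f (Fin.contractNth i.castSucc (· * ·) a)
      + (-1 : ℤ) ^ (n + 1) • r a := by
  simp [faceSum]

/-- The terms `A ⊗ A ⊗ A^{⊗ n}` of the bar resolution; the two outer factors come first. -/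
abbrev Bar (n : ℕ) : Type _ := Env k A ⊗[k] (⨂[k] _ : Fin n, A)

/-- The multilinear map `(a₁, …, aₙ) ↦ s ⊗ a₁ ⊗ ⋯ ⊗ aₙ`, linear in `s`. -/
noncomputable def barCochain (n : ℕ) :
    Env k A →ₗ[k] MultilinearMap k (fun _ : Fin n => A) (Bar k A n) where
  toFun s := (TensorProduct.mk k (Env k A) (⨂[k] _ : Fin n, A) s).compMultilinearMap
    (PiTensorProduct.tprod k)
  map_add' s t := by ext; simp
  map_smul' c s := by ext; simp

/-- The multilinear map `(a₀, …, aₙ) ↦ (1 ⊗ aₙ) ⊗ a₀ ⊗ ⋯ ⊗ aₙ₋₁`. -/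
noncomputable def barRightFace (n : ℕ) :
    MultilinearMap k (fun _ : Fin (n + 1) => A) (Bar k A n) :=
  MultilinearMap.uncurryRight
    (((TensorProduct.mk k (Env k A) (⨂[k] _ : Fin n, A) ∘ₗ
      (Env.inr k A).toLinearMap).flip).compMultilinearMap (PiTensorProduct.tprod k))

/-- The differential of the bar resolution. -/
noncomputable def barD (n : ℕ) : Bar k A (n + 1) →ₗ[Env k A] Bar k A n :=
  LinearMap.liftBaseChange (Env k A) (PiTensorProduct.lift
    (faceSum (barCochain k A n 1)
      (LinearMap.uncurryLeft (barCochain k A n ∘ₗ (Env.inl k A).toLinearMap))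
      (barRightFace k A n)))

variable {k A}

theorem barD_tmul_tprod (n : ℕ) (s : Env k A) (a : Fin (n + 1) → A) :
    barD k A n (s ⊗ₜ[k] PiTensorProduct.tprod k a) =
      (s * Env.inl k A (a 0)) ⊗ₜ[k] PiTensorProduct.tprod k (Fin.tail a)
      + ∑ i : Fin n, (-1 : ℤ) ^ ((i : ℕ) + 1) •
          s ⊗ₜ[k] PiTensorProduct.tprod k (Fin.contractNth i.castSucc (· * ·) a)
      + (-1 : ℤ) ^ (n + 1) •
          (s * Env.inr k A (a (Fin.last n))) ⊗ₜ[k] PiTensorProduct.tprod k (Fin.init a) := by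
  rw [barD, LinearMap.liftBaseChange_tmul, PiTensorProduct.lift.tprod, faceSum_apply]
  simp [barCochain, barRightFace, Finset.smul_sum, TensorProduct.smul_tmul', -zsmul_eq_mul]
  refine Finset.sum_congr rfl fun i _ => ?_
  rw [zsmul_eq_mul, mul_comm]
  push_cast
  rfl

variable (k A) in
/-- The contracting homotopy `(a ⊗ a') ⊗ a₁ ⊗ ⋯ ⊗ aₙ ↦ (1 ⊗ a') ⊗ a ⊗ a₁ ⊗ ⋯ ⊗ aₙ`. -/
noncomputable def barS (n : ℕ) : Bar k A n →ₗ[k] Bar k A (n + 1) :=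
  TensorProduct.lift (Env.lift
    (LinearMap.mk₂ k
      (fun a a' => (TensorProduct.mk k (Env k A) (⨂[k] _ : Fin (n + 1), A) (Env.inr k A a')) ∘ₗ
        PiTensorProduct.lift
          ((PiTensorProduct.tprod k (s := fun _ : Fin (n + 1) => A)).curryLeft a))
      (by intro a b c; ext; simp [TensorProduct.tmul_add])
      (by intro a b c; ext; simp)
      (by intro a b c; ext; simp)
      (by intro a b c; ext; simp)))

theorem barS_tmul (n : ℕ) (a a' : A) (t : Fin n → A) :
    barS k A n ((Env.inl k A a * Env.inr k A a') ⊗ₜ PiTensorProduct.tprod k t) =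
      Env.inr k A a' ⊗ₜ PiTensorProduct.tprod k (Fin.cons a t : Fin (n + 1) → A) := by
  simp [barS]

theorem bar_hom_ext {n : ℕ} {M : Type*} [AddCommGroup M] [Module k M]
    {f g : Bar k A n →ₗ[k] M}
    (h : ∀ (a a' : A) (t : Fin n → A),
      f ((Env.inl k A a * Env.inr k A a') ⊗ₜ PiTensorProduct.tprod k t) =
      g ((Env.inl k A a * Env.inr k A a') ⊗ₜ PiTensorProduct.tprod k t)) : f = g :=
  TensorProduct.ext <| Env.hom_ext fun a a' => PiTensorProduct.ext <| MultilinearMap.ext fun t =>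
    h a a' t

/-- Prepending `a` shifts every face by one position and so reverses its sign. Everything cancels
except the new first face, which multiplies `a` back into the left factor. -/
theorem barD_barS (n : ℕ) (x : Bar k A (n + 1)) :
    barD k A (n + 1) (barS k A (n + 1) x) + barS k A n (barD k A n x) = x := by
  suffices h : (barD k A (n + 1)).restrictScalars k ∘ₗ barS k A (n + 1) +
      barS k A n ∘ₗ (barD k A n).restrictScalars k = LinearMap.id from LinearMap.congr_fun h x
  refine bar_hom_ext fun a a' t => ?_
  have h1 : ∀ b : A, Env.inl k A a * Env.inr k A a' * Env.inl k A b =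
    Env.inl k A (a * b) * Env.inr k A a' := fun b => by rw [map_mul]; ring
  have h2 : ∀ b : A, Env.inl k A a * Env.inr k A a' * Env.inr k A b =
    Env.inl k A a * Env.inr k A (a' * b) := fun b => by rw [map_mul]; ring
  simp only [LinearMap.add_apply, LinearMap.comp_apply, LinearMap.restrictScalars_apply,
    LinearMap.id_apply, barS_tmul, barD_tmul_tprod, map_add, map_sum, map_zsmul, h1, h2,
    Fin.cons_zero, Fin.tail_cons,
    Fin.sum_univ_succ, contractNth_zero_cons, contractNth_succ_cons, init_cons,
    ← Fin.succ_last, Fin.cons_succ, Fin.val_zero, Fin.val_succ, ← map_mul]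
  simp only [pow_succ, mul_neg, mul_one, neg_smul, Finset.sum_neg_distrib, neg_neg,
    mul_comm (Env.inr k A a') (Env.inl k A a), pow_zero, one_smul]
  abel

variable (k A) in
/-- The augmentation of the bar resolution. -/
noncomputable def barAug : Bar k A 0 →ₗ[Env k A] A :=
  LinearMap.liftBaseChange (Env k A)
    (PiTensorProduct.lift (MultilinearMap.constOfIsEmpty k (fun _ : Fin 0 => A) (1 : A)))

theorem barAug_tmul_tprod (s : Env k A) (t : Fin 0 → A) :
    barAug k A (s ⊗ₜ PiTensorProduct.tprod k t) = Env.mul k A s := by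
  simp [barAug, Algebra.smul_def, Env.algebraMap_apply]

theorem barD_barS_zero (x : Bar k A 0) :
    barD k A 0 (barS k A 0 x) +
      Env.inr k A (barAug k A x) ⊗ₜ PiTensorProduct.tprod k (fun i => i.elim0) = x := by
  suffices h : (barD k A 0).restrictScalars k ∘ₗ barS k A 0 +
      (TensorProduct.mk k (Env k A) (⨂[k] _ : Fin 0, A)).flip
        (PiTensorProduct.tprod k (fun i => i.elim0)) ∘ₗ (Env.inr k A).toLinearMap ∘ₗ
        (barAug k A).restrictScalars k = LinearMap.id from LinearMap.congr_fun h x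
  refine bar_hom_ext fun a a' t => ?_
  have ht : Fin.init (Fin.cons a t : Fin 1 → A) = t := Subsingleton.elim _ _
  have ht' : (fun i : Fin 0 => (i.elim0 : A)) = t := Subsingleton.elim _ _
  simp [barS_tmul, barD_tmul_tprod, barAug_tmul_tprod, ht, ht', mul_comm]

/-- The elements `1 ⊗ a₁ ⊗ ⋯` generate over `Env k A` and lie in the image of `barS`: take `a` to be
the first entry and `a' = 1`. The map `barS` itself is only `k`-linear. -/
theorem eq_zero_of_comp_barS {n : ℕ} {M : Type*} [AddCommGroup M] [Module (Env k A) M]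
    (f : Bar k A (n + 1) →ₗ[Env k A] M) (h : ∀ x, f (barS k A n x) = 0) (y) : f y = 0 := by
  induction y using TensorProduct.induction_on with
  | zero => simp
  | add x y hx hy => simp [hx, hy]
  | tmul s t =>
    induction t using PiTensorProduct.induction_on with
    | smul_tprod c t =>
      have h1 := h ((Env.inl k A (t 0) * Env.inr k A 1) ⊗ₜ PiTensorProduct.tprod k (Fin.tail t))
      rw [barS_tmul, Fin.cons_self_tail, map_one] at h1
      have h2 : s ⊗ₜ[k] (c • PiTensorProduct.tprod k t) =
          (c • s) • ((1 : Env k A) ⊗ₜ[k] PiTensorProduct.tprod k t) := by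
        rw [TensorProduct.smul_tmul', smul_eq_mul, mul_one, TensorProduct.tmul_smul,
          TensorProduct.smul_tmul']
      rw [h2, map_smul, h1, smul_zero]
    | add x y hx hy => rw [TensorProduct.tmul_add, map_add, hx, hy, add_zero]

theorem barAug_barD (y : Bar k A 1) : barAug k A (barD k A 0 y) = 0 :=
  eq_zero_of_comp_barS (barAug k A ∘ₗ barD k A 0) (fun x => by
    have h := congrArg (barAug k A) (barD_barS_zero x)
    simpa [barAug_tmul_tprod] using h) y

/-- Induction replaces the usual double sum: with `d`, `s` the differential and the homotopy, `ds +
sd = 1` gives `dds = d - dsd = sdd`, which vanishes by the previous degree, and the image of `s`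
suffices. In degree 0 the augmentation plays the part of the preceding differential. -/
theorem barD_barD (n : ℕ) (y : Bar k A (n + 2)) : barD k A n (barD k A (n + 1) y) = 0 := by
  induction n with
  | zero =>
    refine eq_zero_of_comp_barS (barD k A 0 ∘ₗ barD k A 1) (fun x => ?_) y
    have h := congrArg (barD k A 0) (barD_barS 0 x)
    have h' := barD_barS_zero (barD k A 0 x)
    rw [barAug_barD, map_zero, TensorProduct.zero_tmul, add_zero] at h'
    simpa [h'] using h
  | succ n ih =>
    refine eq_zero_of_comp_barS (barD k A (n + 1) ∘ₗ barD k A (n + 2)) (fun x => ?_) y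
    have h := congrArg (barD k A (n + 1)) (barD_barS (n + 1) x)
    have h' := barD_barS n (barD k A (n + 1) x)
    rw [ih x, map_zero, add_zero] at h'
    simpa [h'] using h

variable (k A) in
theorem isResolution_bar : IsResolution (barD k A) (barAug k A) where
  surjective a := ⟨Env.inl k A a ⊗ₜ PiTensorProduct.tprod k (fun i => i.elim0), by
    simp [barAug_tmul_tprod]⟩
  exact_zero x := ⟨fun h => ⟨barS k A 0 x, by simpa [h] using barD_barS_zero x⟩, by
    rintro ⟨y, rfl⟩; exact barAug_barD y⟩
  exact_succ n x := ⟨fun h => ⟨barS k A (n + 1) x, by simpa [h] using barD_barS n x⟩, by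
    rintro ⟨y, rfl⟩; exact barD_barD n y⟩

/-- The Hochschild chains are the base change of the bar resolution. -/
noncomputable def chainEquiv (k A : Type*) [CommRing k] [CommRing A] [Algebra k A] (n : ℕ) :
    A ⊗[Env k A] Bar k A n ≃ₗ[A] Chain k A n :=
  TensorProduct.AlgebraTensorModule.cancelBaseChange k (Env k A) A A (⨂[k] _ : Fin n, A)

theorem chainEquiv_tmul (n : ℕ) (a : A) (s : Env k A) (t : ⨂[k] _ : Fin n, A) :
    chainEquiv k A n (a ⊗ₜ (s ⊗ₜ t)) = (Env.mul k A s * a) ⊗ₜ t := by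
  rw [chainEquiv, TensorProduct.AlgebraTensorModule.cancelBaseChange_tmul, Algebra.smul_def,
    Env.algebraMap_apply]

/-- After base change along multiplication the left and the right factor of `Env k A` act alike, so
both outer faces become multiplication of the coefficient. -/
theorem boundary_chainEquiv (n : ℕ) :
    boundary k A n ∘ₗ (chainEquiv k A (n + 1)).toLinearMap =
      (chainEquiv k A n).toLinearMap ∘ₗ (barD k A n).baseChange A := by
  refine TensorProduct.AlgebraTensorModule.ext fun a y => ?_
  induction y using TensorProduct.induction_on with
  | zero => simp
  | add x y hx hy => rw [TensorProduct.tmul_add, map_add, map_add, hx, hy]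
  | tmul s t =>
    induction t using PiTensorProduct.induction_on with
    | smul_tprod c t =>
      have h2 : s ⊗ₜ[k] (c • PiTensorProduct.tprod k t) =
          (c • s) ⊗ₜ[k] PiTensorProduct.tprod k t := by
        rw [TensorProduct.tmul_smul, TensorProduct.smul_tmul']
      rw [h2]
      generalize c • s = s
      let L := (chainEquiv k A n).toLinearMap.toAddMonoidHom.comp
        (TensorProduct.mk (Env k A) A (Bar k A n) a).toAddMonoidHom
      have hL : ∀ s t, L (s ⊗ₜ t) = (Env.mul k A s * a) ⊗ₜ t := chainEquiv_tmul n a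
      have hL' : ∀ y, (chainEquiv k A n).toLinearMap (a ⊗ₜ y) = L y := fun _ => rfl
      rw [LinearMap.comp_apply, LinearMap.comp_apply, LinearMap.baseChange_tmul, hL',
        LinearEquiv.coe_coe, barD_tmul_tprod, chainEquiv_tmul, boundary_tmul_tprod]
      simp only [map_add, map_sum, map_zsmul, hL, map_mul, Env.mul_inl, Env.mul_inr]
      congr 3
      · ring
      · ring
    | add x y hx hy =>
      rw [TensorProduct.tmul_add, TensorProduct.tmul_add, map_add, map_add, hx, hy]

end Bar

end Hochschild

/-! ### Homotopy equivalences and the isomorphisms they induce. -/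

/-- A homotopy equivalence between two complexes of modules indexed by `ℕ`. -/
structure HtpyEquiv {S : Type*} [CommRing S] {M N : ℕ → Type*} [∀ n, AddCommGroup (M n)]
    [∀ n, AddCommGroup (N n)] [∀ n, Module S (M n)] [∀ n, Module S (N n)]
    (dM : ∀ n, M (n + 1) →ₗ[S] M n) (dN : ∀ n, N (n + 1) →ₗ[S] N n) where
  f : ∀ n, M n →ₗ[S] N n
  g : ∀ n, N n →ₗ[S] M n
  f_comm : ∀ n x, f n (dM n x) = dN n (f (n + 1) x)
  g_comm : ∀ n x, g n (dN n x) = dM n (g (n + 1) x)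
  h : ∀ n, M n →ₗ[S] M (n + 1)
  h' : ∀ n, N n →ₗ[S] N (n + 1)
  gf_zero : ∀ x, g 0 (f 0 x) - x = dM 0 (h 0 x)
  gf_succ : ∀ n x, g (n + 1) (f (n + 1) x) - x = dM (n + 1) (h (n + 1) x) + h n (dM n x)
  fg_zero : ∀ x, f 0 (g 0 x) - x = dN 0 (h' 0 x)
  fg_succ : ∀ n x, f (n + 1) (g (n + 1) x) - x = dN (n + 1) (h' (n + 1) x) + h' n (dN n x)

namespace HtpyEquiv

variable {S : Type*} [CommRing S] {M N : ℕ → Type*} [∀ n, AddCommGroup (M n)]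
    [∀ n, AddCommGroup (N n)] [∀ n, Module S (M n)] [∀ n, Module S (N n)]
    {dM : ∀ n, M (n + 1) →ₗ[S] M n} {dN : ∀ n, N (n + 1) →ₗ[S] N n}

/-- Both composites of the comparison maps differ from the identity by a chain map that vanishes
under the augmentation, hence is null-homotopic. -/
theorem exists_of_isResolution {E : Type*} [AddCommGroup E] [Module S E]
    [∀ n, Module.Projective S (M n)] [∀ n, Module.Projective S (N n)]
    {εM : M 0 →ₗ[S] E} {εN : N 0 →ₗ[S] E}
    (hM : IsResolution dM εM) (hN : IsResolution dN εN) : Nonempty (HtpyEquiv dM dN) := by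
  obtain ⟨f, hf₀, hf⟩ := hM.exists_chainMap hN
  obtain ⟨g, hg₀, hg⟩ := hN.exists_chainMap hM
  have hf' : ∀ n x, f n (dM n x) = dN n (f (n + 1) x) := fun n x =>
    (LinearMap.congr_fun (hf n) x).symm
  have hg' : ∀ n x, g n (dN n x) = dM n (g (n + 1) x) := fun n x =>
    (LinearMap.congr_fun (hg n) x).symm
  have hf₀' : ∀ x, εN (f 0 x) = εM x := fun x => LinearMap.congr_fun hf₀ x
  have hg₀' : ∀ x, εM (g 0 x) = εN x := fun x => LinearMap.congr_fun hg₀ x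
  obtain ⟨h, h0, h1⟩ := hM.exists_homotopy hM (fun n => g n ∘ₗ f n - LinearMap.id)
    (by ext x; simp [hf₀', hg₀']) (fun n => by ext x; simp [hf', hg'])
  obtain ⟨h', h0', h1'⟩ := hN.exists_homotopy hN (fun n => f n ∘ₗ g n - LinearMap.id)
    (by ext x; simp [hf₀', hg₀']) (fun n => by ext x; simp [hf', hg'])
  exact ⟨⟨f, g, hf', hg', h, h', fun x => LinearMap.congr_fun h0 x,
    fun n x => LinearMap.congr_fun (h1 n) x, fun x => LinearMap.congr_fun h0' x,
    fun n x => LinearMap.congr_fun (h1' n) x⟩⟩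

/-- Base change of a homotopy equivalence. -/
noncomputable def baseChange (A : Type*) [CommRing A] [Algebra S A] (H : HtpyEquiv dM dN) :
    HtpyEquiv (M := fun n => A ⊗[S] M n) (N := fun n => A ⊗[S] N n)
      (fun n => (dM n).baseChange A) (fun n => (dN n).baseChange A) where
  f n := (H.f n).baseChange A
  g n := (H.g n).baseChange A
  h n := (H.h n).baseChange A
  h' n := (H.h' n).baseChange A
  f_comm n := LinearMap.congr_fun (f := (H.f n).baseChange A ∘ₗ (dM n).baseChange A)
    (g := (dN n).baseChange A ∘ₗ (H.f (n + 1)).baseChange A) (by ext x; simp [H.f_comm])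
  g_comm n := LinearMap.congr_fun (f := (H.g n).baseChange A ∘ₗ (dN n).baseChange A)
    (g := (dM n).baseChange A ∘ₗ (H.g (n + 1)).baseChange A) (by ext x; simp [H.g_comm])
  gf_zero := LinearMap.congr_fun
    (f := (H.g 0).baseChange A ∘ₗ (H.f 0).baseChange A - LinearMap.id)
    (g := (dM 0).baseChange A ∘ₗ (H.h 0).baseChange A)
    (by ext x; simp [← TensorProduct.tmul_sub, H.gf_zero])
  gf_succ n := LinearMap.congr_fun
    (f := (H.g (n + 1)).baseChange A ∘ₗ (H.f (n + 1)).baseChange A - LinearMap.id)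
    (g := (dM (n + 1)).baseChange A ∘ₗ (H.h (n + 1)).baseChange A +
      (H.h n).baseChange A ∘ₗ (dM n).baseChange A)
    (by ext x; simp [← TensorProduct.tmul_sub, H.gf_succ, TensorProduct.tmul_add])
  fg_zero := LinearMap.congr_fun
    (f := (H.f 0).baseChange A ∘ₗ (H.g 0).baseChange A - LinearMap.id)
    (g := (dN 0).baseChange A ∘ₗ (H.h' 0).baseChange A)
    (by ext x; simp [← TensorProduct.tmul_sub, H.fg_zero])
  fg_succ n := LinearMap.congr_fun
    (f := (H.f (n + 1)).baseChange A ∘ₗ (H.g (n + 1)).baseChange A - LinearMap.id)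
    (g := (dN (n + 1)).baseChange A ∘ₗ (H.h' (n + 1)).baseChange A +
      (H.h' n).baseChange A ∘ₗ (dN n).baseChange A)
    (by ext x; simp [← TensorProduct.tmul_sub, H.fg_succ, TensorProduct.tmul_add])

/-- Transport of a homotopy equivalence along isomorphisms of complexes. -/
noncomputable def congr {M' N' : ℕ → Type*} [∀ n, AddCommGroup (M' n)]
    [∀ n, AddCommGroup (N' n)] [∀ n, Module S (M' n)] [∀ n, Module S (N' n)]
    {dM' : ∀ n, M' (n + 1) →ₗ[S] M' n} {dN' : ∀ n, N' (n + 1) →ₗ[S] N' n}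
    (H : HtpyEquiv dM dN) (e : ∀ n, M n ≃ₗ[S] M' n) (e' : ∀ n, N n ≃ₗ[S] N' n)
    (he : ∀ n x, dM' n (e (n + 1) x) = e n (dM n x))
    (he' : ∀ n x, dN' n (e' (n + 1) x) = e' n (dN n x)) : HtpyEquiv dM' dN' :=
  have ae : ∀ n x, (e n).symm (dM' n x) = dM n ((e (n + 1)).symm x) := fun n x => by
    rw [LinearEquiv.symm_apply_eq, ← he, LinearEquiv.apply_symm_apply]
  have ae' : ∀ n x, (e' n).symm (dN' n x) = dN n ((e' (n + 1)).symm x) := fun n x => by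
    rw [LinearEquiv.symm_apply_eq, ← he', LinearEquiv.apply_symm_apply]
  { f := fun n => (e' n).toLinearMap ∘ₗ H.f n ∘ₗ (e n).symm.toLinearMap
    g := fun n => (e n).toLinearMap ∘ₗ H.g n ∘ₗ (e' n).symm.toLinearMap
    h := fun n => (e (n + 1)).toLinearMap ∘ₗ H.h n ∘ₗ (e n).symm.toLinearMap
    h' := fun n => (e' (n + 1)).toLinearMap ∘ₗ H.h' n ∘ₗ (e' n).symm.toLinearMap
    f_comm := fun n x => by simp [ae, H.f_comm, he']
    g_comm := fun n x => by simp [ae', H.g_comm, he]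
    gf_zero := fun x => by
      have := congrArg (e 0) (H.gf_zero ((e 0).symm x))
      simpa [he] using this
    gf_succ := fun n x => by
      have := congrArg (e (n + 1)) (H.gf_succ n ((e (n + 1)).symm x))
      simpa [he, ae] using this
    fg_zero := fun x => by
      have := congrArg (e' 0) (H.fg_zero ((e' 0).symm x))
      simpa [he'] using this
    fg_succ := fun n x => by
      have := congrArg (e' (n + 1)) (H.fg_succ n ((e' (n + 1)).symm x))
      simpa [he', ae'] using this }

/-- The isomorphism on homology in degree zero. -/
noncomputable def homologyZero (H : HtpyEquiv dM dN) :
    ((⊤ : Submodule S (M 0)) ⧸ (LinearMap.range (dM 0)).submoduleOf ⊤) ≃ₗ[S]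
      ((⊤ : Submodule S (N 0)) ⧸ (LinearMap.range (dN 0)).submoduleOf ⊤) :=
  Submodule.subquotientEquiv (H.f 0) (H.g 0) (fun _ _ => trivial)
    (by rintro _ ⟨y, rfl⟩; exact ⟨_, (H.f_comm 0 y).symm⟩) (fun _ _ => trivial)
    (by rintro _ ⟨y, rfl⟩; exact ⟨_, (H.g_comm 0 y).symm⟩)
    (fun x _ => ⟨_, (H.gf_zero x).symm⟩) (fun x _ => ⟨_, (H.fg_zero x).symm⟩)

/-- The isomorphism on homology in positive degrees. -/
noncomputable def homologySucc (H : HtpyEquiv dM dN) (n : ℕ) :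
    (LinearMap.ker (dM n) ⧸ (LinearMap.range (dM (n + 1))).submoduleOf (LinearMap.ker (dM n)))
      ≃ₗ[S]
    (LinearMap.ker (dN n) ⧸ (LinearMap.range (dN (n + 1))).submoduleOf (LinearMap.ker (dN n))) :=
  Submodule.subquotientEquiv (H.f (n + 1)) (H.g (n + 1))
    (fun x hx => by
      rw [LinearMap.mem_ker] at hx ⊢; rw [← H.f_comm, hx, map_zero])
    (by rintro _ ⟨y, rfl⟩; exact ⟨_, (H.f_comm _ y).symm⟩)
    (fun x hx => by
      rw [LinearMap.mem_ker] at hx ⊢; rw [← H.g_comm, hx, map_zero])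
    (by rintro _ ⟨y, rfl⟩; exact ⟨_, (H.g_comm _ y).symm⟩)
    (fun x hx => ⟨_, by rw [H.gf_succ, LinearMap.mem_ker.1 hx, (H.h n).map_zero, add_zero]⟩)
    (fun x hx => ⟨_, by rw [H.fg_succ, LinearMap.mem_ker.1 hx, (H.h' n).map_zero, add_zero]⟩)

/-- The isomorphism on cohomology of the dual complexes in degree zero. -/
noncomputable def cohomologyZero (H : HtpyEquiv dM dN) :
    (LinearMap.ker (dM 0).dualMap ⧸ (⊥ : Submodule S (Module.Dual S (M 0))).submoduleOf
      (LinearMap.ker (dM 0).dualMap)) ≃ₗ[S]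
    (LinearMap.ker (dN 0).dualMap ⧸ (⊥ : Submodule S (Module.Dual S (N 0))).submoduleOf
      (LinearMap.ker (dN 0).dualMap)) :=
  Submodule.subquotientEquiv (H.g 0).dualMap (H.f 0).dualMap
    (fun φ hφ => LinearMap.ext fun x => by
      have := LinearMap.congr_fun (LinearMap.mem_ker.1 hφ) (H.g 1 x)
      simpa [H.g_comm] using this)
    (by rintro _ rfl; simp)
    (fun φ hφ => LinearMap.ext fun x => by
      have := LinearMap.congr_fun (LinearMap.mem_ker.1 hφ) (H.f 1 x)
      simpa [H.f_comm] using this)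
    (by rintro _ rfl; simp)
    (fun φ hφ => LinearMap.ext fun x => by
      have := LinearMap.congr_fun (LinearMap.mem_ker.1 hφ) (H.h 0 x)
      simpa [← H.gf_zero] using this)
    (fun φ hφ => LinearMap.ext fun x => by
      have := LinearMap.congr_fun (LinearMap.mem_ker.1 hφ) (H.h' 0 x)
      simpa [← H.fg_zero] using this)

/-- The isomorphism on cohomology of the dual complexes in positive degrees. -/
noncomputable def cohomologySucc (H : HtpyEquiv dM dN) (n : ℕ) :
    (LinearMap.ker (dM (n + 1)).dualMap ⧸ (LinearMap.range (dM n).dualMap).submoduleOf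
      (LinearMap.ker (dM (n + 1)).dualMap)) ≃ₗ[S]
    (LinearMap.ker (dN (n + 1)).dualMap ⧸ (LinearMap.range (dN n).dualMap).submoduleOf
      (LinearMap.ker (dN (n + 1)).dualMap)) :=
  Submodule.subquotientEquiv (H.g (n + 1)).dualMap (H.f (n + 1)).dualMap
    (fun φ hφ => LinearMap.ext fun x => by
      have := LinearMap.congr_fun (LinearMap.mem_ker.1 hφ) (H.g (n + 2) x)
      simpa [H.g_comm] using this)
    (by
      rintro _ ⟨φ, rfl⟩
      exact ⟨(H.g n).dualMap φ, LinearMap.ext fun x => congrArg φ (H.g_comm n x)⟩)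
    (fun φ hφ => LinearMap.ext fun x => by
      have := LinearMap.congr_fun (LinearMap.mem_ker.1 hφ) (H.f (n + 2) x)
      simpa [H.f_comm] using this)
    (by
      rintro _ ⟨φ, rfl⟩
      exact ⟨(H.f n).dualMap φ, LinearMap.ext fun x => congrArg φ (H.f_comm n x)⟩)
    (fun φ hφ => ⟨(H.h n).dualMap φ, LinearMap.ext fun x => by
      have h1 := LinearMap.congr_fun (LinearMap.mem_ker.1 hφ) (H.h (n + 1) x)
      have h2 := congrArg φ (H.gf_succ n x)
      simp only [LinearMap.dualMap_apply, LinearMap.zero_apply] at h1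
      simpa [h1] using h2.symm⟩)
    (fun φ hφ => ⟨(H.h' n).dualMap φ, LinearMap.ext fun x => by
      have h1 := LinearMap.congr_fun (LinearMap.mem_ker.1 hφ) (H.h' (n + 1) x)
      have h2 := congrArg φ (H.fg_succ n x)
      simp only [LinearMap.dualMap_apply, LinearMap.zero_apply] at h1
      simpa [h1] using h2.symm⟩)

end HtpyEquiv

/-- An isomorphism of ambient modules induces an isomorphism of subquotients. -/
noncomputable def Submodule.subquotientCongr {A X Y : Type*} [CommRing A] [AddCommGroup X]
    [AddCommGroup Y] [Module A X] [Module A Y] {Z B : Submodule A X} {Z' B' : Submodule A Y}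
    (e : X ≃ₗ[A] Y) (hZ : ∀ x, e x ∈ Z' ↔ x ∈ Z) (hB : ∀ x, e x ∈ B' ↔ x ∈ B) :
    (Z ⧸ B.submoduleOf Z) ≃ₗ[A] (Z' ⧸ B'.submoduleOf Z') :=
  Submodule.subquotientEquiv e.toLinearMap e.symm.toLinearMap (fun x hx => (hZ x).2 hx)
    (fun x hx => (hB x).2 hx) (fun y hy => (hZ _).1 (by simpa using hy))
    (fun y hy => (hB _).1 (by simpa using hy)) (fun x _ => by simp) (fun y _ => by simp)

/-! ### Hochschild (co)homology from an arbitrary finite free resolution. -/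

namespace Hochschild

section Dual

variable (k A : Type*) [CommRing k] [CommRing A] [Algebra k A]

/-- Hochschild cochains are the linear forms on the Hochschild chains. -/
noncomputable def cochainEquiv (n : ℕ) : Cochain k A n ≃ₗ[A] Module.Dual A (Chain k A n) where
  toFun f := LinearMap.liftBaseChange A (PiTensorProduct.lift f)
  invFun φ := (φ.restrictScalars k).compMultilinearMap (tensorCochain k A n)
  map_add' f g := by
    ext; simp
  map_smul' a f := by
    ext; simp
  left_inv f := by
    ext; simp [tensorCochain]
  right_inv φ := by
    ext; simp [tensorCochain]

variable {k A}

/-- A linear form on `A ⊗ A^{⊗ n}` is determined on the elements `1 ⊗ a₁ ⊗ ⋯ ⊗ aₙ`, where the two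
formulas agree term by term. -/
theorem cochainEquiv_coboundary (n : ℕ) (f : Cochain k A n) :
    cochainEquiv k A (n + 1) (coboundary k A A n f) =
      (boundary k A n).dualMap (cochainEquiv k A n f) := by
  rw [← LinearEquiv.eq_symm_apply]
  refine MultilinearMap.ext fun a => ?_
  change _ = (cochainEquiv k A n f) (boundary k A n (1 ⊗ₜ PiTensorProduct.tprod k a))
  rw [boundary_tmul_tprod, coboundary_apply]
  simp [cochainEquiv, TensorProduct.smul_tmul', mul_assoc]

end Dual

section

variable {k A : Type*} [Field k] [CommRing A] [Algebra k A] {r : ℕ → ℕ}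
  {d : ∀ n, Matrix (Fin (r n)) (Fin (r (n + 1))) (Env k A)}
  {ε : (Fin (r 0) → Env k A) →ₗ[Env k A] A}

/-- Over a field the tensor powers of `A` are free, so the bar terms are projective over `Env k A`.
Base change turns the free modules into powers of `A` and multiplies out the matrix entries. -/
theorem exists_htpyEquiv
    (h : IsResolution (N := fun n => Fin (r n) → Env k A) (fun n => (d n).mulVecLin) ε) :
    Nonempty (HtpyEquiv (N := fun n => Fin (r n) → A) (boundary k A)
      (fun n => ((d n).map (Env.mul k A)).mulVecLin)) := by
  obtain ⟨H⟩ := HtpyEquiv.exists_of_isResolution (isResolution_bar k A) h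
  refine ⟨(H.baseChange A).congr (chainEquiv k A)
    (fun n => TensorProduct.piScalarRight (Env k A) A A (Fin (r n)))
    (fun n x => LinearMap.congr_fun (boundary_chainEquiv n) x) (fun n => ?_)⟩
  refine LinearMap.congr_fun (f := ((d n).map (Env.mul k A)).mulVecLin ∘ₗ
    (TensorProduct.piScalarRight (Env k A) A A (Fin (r (n + 1)))).toLinearMap)
    (g := (TensorProduct.piScalarRight (Env k A) A A (Fin (r n))).toLinearMap ∘ₗ
      ((d n).mulVecLin).baseChange A) ?_
  refine TensorProduct.AlgebraTensorModule.ext fun a y => funext fun i => ?_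
  simp [Matrix.mulVec, dotProduct, Algebra.smul_def, Env.algebraMap_apply, Finset.sum_mul, mul_assoc]

theorem dotProductEquiv_transpose_mulVec {m n : ℕ} (M : Matrix (Fin m) (Fin n) A) (x : Fin m → A) :
    dotProductEquiv A (Fin n) (M.transpose.mulVecLin x) =
      M.mulVecLin.dualMap (dotProductEquiv A (Fin m) x) := by
  refine LinearMap.ext fun y => ?_
  change Matrix.mulVec M.transpose x ⬝ᵥ y = x ⬝ᵥ Matrix.mulVec M y
  rw [Matrix.mulVec_transpose, Matrix.dotProduct_mulVec]

theorem homology_zero_of_isResolution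
    (h : IsResolution (N := fun n => Fin (r n) → Env k A) (fun n => (d n).mulVecLin) ε) :
    Nonempty (Homology k A 0 ≃ₗ[A]
      ((⊤ : Submodule A (Fin (r 0) → A)) ⧸
        (LinearMap.range ((d 0).map (Env.mul k A)).mulVecLin).submoduleOf ⊤)) :=
  (exists_htpyEquiv h).map fun H => H.homologyZero

theorem homology_succ_of_isResolution
    (h : IsResolution (N := fun n => Fin (r n) → Env k A) (fun n => (d n).mulVecLin) ε)
    (n : ℕ) :
    Nonempty (Homology k A (n + 1) ≃ₗ[A]
      (LinearMap.ker ((d n).map (Env.mul k A)).mulVecLin ⧸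
        (LinearMap.range ((d (n + 1)).map (Env.mul k A)).mulVecLin).submoduleOf
          (LinearMap.ker ((d n).map (Env.mul k A)).mulVecLin))) :=
  (exists_htpyEquiv h).map fun H => H.homologySucc n

theorem mem_ker_dualMap_cochainEquiv {n : ℕ} (x : Cochain k A n) :
    cochainEquiv k A n x ∈ LinearMap.ker (boundary k A n).dualMap ↔ x ∈ cocycles k A n := by
  rw [LinearMap.mem_ker, ← cochainEquiv_coboundary, LinearEquiv.map_eq_zero_iff, cocycles,
    LinearMap.mem_ker]

theorem mem_range_dualMap_cochainEquiv {n : ℕ} (x : Cochain k A (n + 1)) :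
    cochainEquiv k A (n + 1) x ∈ LinearMap.range (boundary k A n).dualMap ↔
      x ∈ coboundaries k A (n + 1) := by
  constructor
  · rintro ⟨φ, hφ⟩
    refine ⟨(cochainEquiv k A n).symm φ, (cochainEquiv k A (n + 1)).injective ?_⟩
    rw [cochainEquiv_coboundary, LinearEquiv.apply_symm_apply, hφ]
  · rintro ⟨y, rfl⟩
    exact ⟨cochainEquiv k A n y, (cochainEquiv_coboundary n y).symm⟩

theorem mem_ker_dualMap_dotProductEquiv {m n : ℕ} (M : Matrix (Fin m) (Fin n) A) (x : Fin m → A) :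
    dotProductEquiv A (Fin m) x ∈ LinearMap.ker M.mulVecLin.dualMap ↔
      x ∈ LinearMap.ker M.transpose.mulVecLin := by
  rw [LinearMap.mem_ker, ← dotProductEquiv_transpose_mulVec, LinearEquiv.map_eq_zero_iff,
    LinearMap.mem_ker]

theorem mem_range_dualMap_dotProductEquiv {m n : ℕ} (M : Matrix (Fin m) (Fin n) A)
    (x : Fin n → A) :
    dotProductEquiv A (Fin n) x ∈ LinearMap.range M.mulVecLin.dualMap ↔
      x ∈ LinearMap.range M.transpose.mulVecLin := by
  constructor
  · rintro ⟨φ, hφ⟩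
    refine ⟨(dotProductEquiv A (Fin m)).symm φ, (dotProductEquiv A (Fin n)).injective ?_⟩
    rw [dotProductEquiv_transpose_mulVec, LinearEquiv.apply_symm_apply, hφ]
  · rintro ⟨y, rfl⟩
    exact ⟨dotProductEquiv A (Fin m) y, (dotProductEquiv_transpose_mulVec M y).symm⟩

theorem cohomology_zero_of_isResolution
    (h : IsResolution (N := fun n => Fin (r n) → Env k A) (fun n => (d n).mulVecLin) ε) :
    Nonempty (Cohomology k A 0 ≃ₗ[A]
      (LinearMap.ker ((d 0).map (Env.mul k A)).transpose.mulVecLin ⧸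
        (⊥ : Submodule A (Fin (r 0) → A)).submoduleOf
          (LinearMap.ker ((d 0).map (Env.mul k A)).transpose.mulVecLin))) :=
  (exists_htpyEquiv h).map fun H =>
    Submodule.subquotientCongr (cochainEquiv k A 0) mem_ker_dualMap_cochainEquiv
        (fun _ => (cochainEquiv k A 0).map_eq_zero_iff) ≪≫ₗ H.cohomologyZero ≪≫ₗ
      (Submodule.subquotientCongr (dotProductEquiv A (Fin (r 0)))
        (mem_ker_dualMap_dotProductEquiv _)
        (fun _ => (dotProductEquiv A (Fin (r 0))).map_eq_zero_iff)).symm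

theorem cohomology_succ_of_isResolution
    (h : IsResolution (N := fun n => Fin (r n) → Env k A) (fun n => (d n).mulVecLin) ε)
    (n : ℕ) :
    Nonempty (Cohomology k A (n + 1) ≃ₗ[A]
      (LinearMap.ker ((d (n + 1)).map (Env.mul k A)).transpose.mulVecLin ⧸
        (LinearMap.range ((d n).map (Env.mul k A)).transpose.mulVecLin).submoduleOf
          (LinearMap.ker ((d (n + 1)).map (Env.mul k A)).transpose.mulVecLin))) :=
  (exists_htpyEquiv h).map fun H =>
    Submodule.subquotientCongr (cochainEquiv k A (n + 1)) mem_ker_dualMap_cochainEquiv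
        mem_range_dualMap_cochainEquiv ≪≫ₗ H.cohomologySucc n ≪≫ₗ
      (Submodule.subquotientCongr (dotProductEquiv A (Fin (r (n + 1))))
        (mem_ker_dualMap_dotProductEquiv _) (mem_range_dualMap_dotProductEquiv _)).symm

end

end Hochschild

/-! ### The enveloping algebra of a plane curve as a polynomial quotient; Koszul relations. -/

namespace Hochschild

open MvPolynomial

section Koszul

variable {A : Type*} [CommRing A] (x : Fin 2 → A)

/-- Modulo the two linear forms each variable equals its value, so every polynomial is congruent to
its value at `x`. -/
theorem exists_of_eval_eq_zero {p : MvPolynomial (Fin 2) A} (hp : eval x p = 0) :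
    ∃ a b, p = a * (X 0 - C (x 0)) + b * (X 1 - C (x 1)) := by
  set I : Ideal (MvPolynomial (Fin 2) A) := Ideal.span {X 0 - C (x 0), X 1 - C (x 1)} with hI
  have h : Ideal.Quotient.mk I = ((Ideal.Quotient.mk I).comp C).comp (eval x) := by
    refine ringHom_ext (by simp) fun i => ?_
    simp only [RingHom.comp_apply, eval_X]
    refine (Ideal.Quotient.eq).2 ?_
    fin_cases i
    · exact Ideal.subset_span (by simp)
    · exact Ideal.subset_span (by simp)
  have hpI : p ∈ I := by
    rw [← Ideal.Quotient.eq_zero_iff_mem, h]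
    simp [hp]
  obtain ⟨a, b, hab⟩ := Ideal.mem_span_pair.1 hpI
  exact ⟨a, b, hab.symm⟩

theorem X_mul_eq_zero {σ : Type*} {i : σ} {p : MvPolynomial σ A} (h : p * X i = 0) : p = 0 := by
  exact X_mul_cancel_right_iff.1 (h.trans (zero_mul _).symm)

/-- `A` may have zero divisors, so primality of `X 1` is not available. Instead, setting `X 1 = 0`
and cancelling `X 0` shows that `c₁` vanishes modulo `X 1`. -/
theorem koszul_exact_X {c₁ c₂ : MvPolynomial (Fin 2) A} (h : c₁ * X 0 + c₂ * X 1 = 0) :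
    ∃ b, c₁ = -(b * X 1) ∧ c₂ = b * X 0 := by
  obtain ⟨b, hb⟩ : ∃ b, c₁ = b * X 1 := by
    let ρ : MvPolynomial (Fin 2) A →ₐ[A] MvPolynomial (Fin 2) A := aeval ![X 0, 0]
    have hρ : ρ c₁ = 0 := X_mul_eq_zero (i := 0) (by
      have := congrArg ρ h
      simpa [ρ] using this)
    have h2 : Ideal.Quotient.mk (Ideal.span {(X 1 : MvPolynomial (Fin 2) A)}) =
        (Ideal.Quotient.mk _).comp ρ.toRingHom := by
      refine ringHom_ext (fun r => by simp [ρ]) fun i => ?_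
      fin_cases i
      · simp [ρ]
      · simp [ρ]
    have h3 : c₁ ∈ Ideal.span {(X 1 : MvPolynomial (Fin 2) A)} := by
      rw [← Ideal.Quotient.eq_zero_iff_mem, h2]
      simp [hρ]
    obtain ⟨b, hb⟩ := Ideal.mem_span_singleton'.1 h3
    exact ⟨b, hb.symm⟩
  refine ⟨-b, by rw [hb]; ring, ?_⟩
  have : (c₂ + b * X 0) * X 1 = 0 := by rw [← h, hb]; ring
  linear_combination X_mul_eq_zero this

theorem koszul_exact {c₁ c₂ : MvPolynomial (Fin 2) A}
    (h : c₁ * (X 0 - C (x 0)) + c₂ * (X 1 - C (x 1)) = 0) :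
    ∃ b, c₁ = -(b * (X 1 - C (x 1))) ∧ c₂ = b * (X 0 - C (x 0)) := by
  -- Translation moves the point `x` to the origin.
  let τ : MvPolynomial (Fin 2) A →ₐ[A] MvPolynomial (Fin 2) A := aeval fun i => X i + C (x i)
  let τ' : MvPolynomial (Fin 2) A →ₐ[A] MvPolynomial (Fin 2) A := aeval fun i => X i - C (x i)
  have hτ : ∀ p, τ' (τ p) = p := fun p => by
    refine AlgHom.congr_fun (φ₁ := τ'.comp τ) (φ₂ := AlgHom.id A _) ?_ p
    ext i : 1
    simp [τ, τ', ← algebraMap_eq]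
  obtain ⟨b, h1, h2⟩ := koszul_exact_X (c₁ := τ c₁) (c₂ := τ c₂) (by
    have := congrArg τ h
    simpa [τ, ← algebraMap_eq] using this)
  refine ⟨τ' b, ?_, ?_⟩
  · rw [← hτ c₁, h1]; simp [τ']
  · rw [← hτ c₂, h2]; simp [τ']

end Koszul

section Hypersurface

variable {k : Type*} [Field k] (f : MvPolynomial (Fin 2) k)

/-- The coordinate ring of a plane curve. -/
abbrev Curve : Type _ := MvPolynomial (Fin 2) k ⧸ Ideal.span {f}

/-- The coordinate functions on a plane curve. -/
noncomputable def coord (i : Fin 2) : Curve f := Ideal.Quotient.mk _ (X i)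

theorem aeval_coord (p : MvPolynomial (Fin 2) k) :
    aeval (coord f) p = Ideal.Quotient.mk (Ideal.span {f}) p := by
  have : aeval (coord f) = Ideal.Quotient.mkₐ k (Ideal.span {f}) := by
    ext i; simp [coord]
  rw [this]; rfl

/-- Polynomials over the coordinate ring map onto the enveloping algebra. -/
noncomputable def polyToEnv : MvPolynomial (Fin 2) (Curve f) →+* Env k (Curve f) :=
  eval₂Hom (Env.inl k (Curve f)).toRingHom fun i => Env.inr k (Curve f) (coord f i)

theorem mul_polyToEnv (p) : Env.mul k (Curve f) (polyToEnv f p) = eval (coord f) p := by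
  refine RingHom.congr_fun (f := (Env.mul k (Curve f)).toRingHom.comp (polyToEnv f))
    (g := eval (coord f)) ?_ p
  ext i <;> simp [polyToEnv]

theorem polyToEnv_map (p : MvPolynomial (Fin 2) k) :
    polyToEnv f (map (algebraMap k (Curve f)) p) =
      Env.inr k (Curve f) (Ideal.Quotient.mk _ p) := by
  refine RingHom.congr_fun (f := (polyToEnv f).comp (map (algebraMap k (Curve f))))
    (g := (Env.inr k (Curve f)).toRingHom.comp (Ideal.Quotient.mk _)) ?_ p
  refine ringHom_ext (fun r => ?_) fun i => ?_
  · have h : (Ideal.Quotient.mk (Ideal.span {f})) (C r) = algebraMap k (Curve f) r := rfl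
    simp [polyToEnv, h]
  · simp [polyToEnv, coord]

theorem polyToEnv_surjective : Function.Surjective (polyToEnv f) := by
  intro s
  induction s using TensorProduct.induction_on with
  | zero => exact ⟨0, map_zero _⟩
  | add a b ha hb =>
    obtain ⟨p, rfl⟩ := ha
    obtain ⟨q, rfl⟩ := hb
    exact ⟨p + q, map_add _ _ _⟩
  | tmul a b =>
    obtain ⟨b, rfl⟩ := Ideal.Quotient.mk_surjective b
    refine ⟨C a * map (algebraMap k (Curve f)) b, ?_⟩
    rw [map_mul, polyToEnv_map]
    simp only [polyToEnv, eval₂Hom_C]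
    exact Env.inl_mul_inr _ _

/-- The universal property of the tensor product gives a map `Φ` back to the quotient by `F`, and `Φ
∘ polyToEnv` is the quotient map; hence the kernel lies in `(F)`. -/
theorem dvd_of_polyToEnv_eq_zero {p : MvPolynomial (Fin 2) (Curve f)} (hp : polyToEnv f p = 0) :
    ∃ q, p = map (algebraMap k (Curve f)) f * q := by
  set F := map (algebraMap k (Curve f)) f
  let ψ : Curve f →ₐ[k] MvPolynomial (Fin 2) (Curve f) ⧸ Ideal.span {F} :=
    Ideal.Quotient.liftₐ _ ((Ideal.Quotient.mkₐ k (Ideal.span {F})).comp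
      (mapAlgHom (Algebra.ofId k (Curve f)))) fun a ha => by
        obtain ⟨b, rfl⟩ := Ideal.mem_span_singleton.1 ha
        rw [AlgHom.comp_apply, Ideal.Quotient.mkₐ_eq_mk, Ideal.Quotient.eq_zero_iff_mem, map_mul]
        exact Ideal.mul_mem_right _ _ (Ideal.mem_span_singleton_self _)
  let Φ : Env k (Curve f) →ₐ[k] MvPolynomial (Fin 2) (Curve f) ⧸ Ideal.span {F} :=
    (Algebra.TensorProduct.lift (Algebra.algHom k (Curve f) _) ψ fun _ _ => .all _ _ :
      Curve f ⊗[k] Curve f →ₐ[k] _)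
  have hl : ∀ a, Φ (Env.inl k _ a) = Ideal.Quotient.mk _ (C a) := fun a =>
    (Algebra.TensorProduct.lift_tmul _ _ _ _ _).trans (by simp; rfl)
  have hr : ∀ i, Φ (Env.inr k _ (coord f i)) = Ideal.Quotient.mk _ (X i) := fun i =>
    (Algebra.TensorProduct.lift_tmul _ _ _ _ _).trans (by
      rw [map_one, one_mul]
      exact (Ideal.Quotient.lift_mk _ _ _).trans (by simp))
  have h : Φ.toRingHom.comp (polyToEnv f) = Ideal.Quotient.mk _ := by
    refine ringHom_ext (fun r => ?_) fun i => ?_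
    · simp [polyToEnv, hl]
    · simp [polyToEnv, hr]
  have h2 := RingHom.congr_fun h p
  rw [RingHom.comp_apply, hp, map_zero, eq_comm, Ideal.Quotient.eq_zero_iff_mem] at h2
  obtain ⟨q, hq⟩ := Ideal.mem_span_singleton.1 h2
  exact ⟨q, hq⟩

/-- Multiplication by `f` is injective on the domain `k[X₀, X₁]` and stays so after tensoring with
`A`, which is flat over the field `k`. -/
theorem eq_zero_of_map_mul_eq_zero {A : Type*} [CommRing A] [Algebra k A] {f} (hf : f ≠ 0)
    {p : MvPolynomial (Fin 2) A} (hp : map (algebraMap k A) f * p = 0) : p = 0 := by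
  have h1 : Function.Injective (LinearMap.mulLeft k f) := fun a b hab =>
    mul_left_cancel₀ hf hab
  have h2 := Module.Flat.lTensor_preserves_injective_linearMap (M := A) _ h1
  let e := algebraTensorAlgEquiv (σ := Fin 2) k A
  have h3 : ∀ z : A ⊗[k] MvPolynomial (Fin 2) k,
      e (LinearMap.lTensor A (LinearMap.mulLeft k f) z) = map (algebraMap k A) f * e z := by
    intro z
    induction z using TensorProduct.induction_on with
    | zero => simp
    | add a b ha hb => rw [map_add, map_add, ha, hb, map_add, mul_add]
    | tmul a b =>
      simp [e, MvPolynomial.algebraTensorAlgEquiv_tmul]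
  have h4 : LinearMap.lTensor A (LinearMap.mulLeft k f) (e.symm p) = 0 :=
    e.injective (by rw [h3, AlgEquiv.apply_symm_apply, hp, map_zero])
  simpa using h2 (h4.trans (map_zero _).symm)

end Hypersurface

end Hochschild

/-! ### The two-periodic resolution of the diagonal. -/

namespace Hochschild

open MvPolynomial

section MatrixFactorization

/-- The ranks of the terms of the resolution of the diagonal of a plane curve. -/
def mfRank : ℕ → ℕ
  | 0 => 1
  | _ + 1 => 2

/-- The two-periodic complex of the matrix factorization
`!![g₁, -v; g₂, u] * !![u, v; -g₂, g₁] = g₁ * u + g₂ * v`, augmented by `!![u, v]`. -/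
def mfD {S : Type*} [CommRing S] (u v g₁ g₂ : S) :
    ∀ n, Matrix (Fin (mfRank n)) (Fin (mfRank (n + 1))) S
  | 0 => (!![u, v] : Matrix (Fin 1) (Fin 2) S)
  | n + 1 => (if Even n then !![g₁, -v; g₂, u] else !![u, v; -g₂, g₁] :
      Matrix (Fin 2) (Fin 2) S)

theorem mfD_map {S A : Type*} [CommRing S] [CommRing A] {F : Type*} [FunLike F S A]
    [RingHomClass F S A] (φ : F) (u v g₁ g₂ : S) (n : ℕ) :
    (mfD u v g₁ g₂ n).map φ = mfD (φ u) (φ v) (φ g₁) (φ g₂) n := by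
  cases n with
  | zero =>
    refine Matrix.ext fun i j => ?_
    change φ ((!![u, v] : Matrix (Fin 1) (Fin 2) S) i j) =
      (!![φ u, φ v] : Matrix (Fin 1) (Fin 2) A) i j
    fin_cases i; fin_cases j <;> rfl
  | succ n =>
    refine Matrix.ext fun i j => ?_
    change φ ((if Even n then !![g₁, -v; g₂, u] else !![u, v; -g₂, g₁] :
      Matrix (Fin 2) (Fin 2) S) i j) =
      (if Even n then !![φ g₁, -φ v; φ g₂, φ u] else !![φ u, φ v; -φ g₂, φ g₁] :
      Matrix (Fin 2) (Fin 2) A) i j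
    split_ifs <;> fin_cases i <;> fin_cases j <;> first | rfl | exact map_neg φ _

theorem mfD_odd {S : Type*} [CommRing S] (u v g₁ g₂ : S) (n : ℕ) (hn : Even n) :
    mfD u v g₁ g₂ (n + 1) = (!![g₁, -v; g₂, u] : Matrix (Fin 2) (Fin 2) S) := if_pos hn

theorem mfD_even {S : Type*} [CommRing S] (u v g₁ g₂ : S) (n : ℕ) (hn : ¬ Even n) :
    mfD u v g₁ g₂ (n + 1) = (!![u, v; -g₂, g₁] : Matrix (Fin 2) (Fin 2) S) := if_neg hn

theorem mulVecLin_fin_two {S : Type*} [CommRing S] (a b c d : S) (x : Fin 2 → S) :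
    (!![a, b; c, d]).mulVecLin x = ![a * x 0 + b * x 1, c * x 0 + d * x 1] := by
  ext i; fin_cases i <;> simp [Matrix.mulVec, dotProduct, Fin.sum_univ_two]

theorem mulVecLin_fin_one_two {S : Type*} [CommRing S] (a b : S) (x : Fin 2 → S) :
    (!![a, b]).mulVecLin x = ![a * x 0 + b * x 1] := by
  ext i; fin_cases i; simp [Matrix.mulVec, dotProduct, Fin.sum_univ_two]

/-- `h1`, `h2`, `h3` are exactness written out in elements. The row `u, v` occurs both in the first
differential and in the even matrices, so `h2` serves for both: for an even matrix the first row
alone already forces a preimage. -/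
theorem isResolution_mfD {S A : Type*} [CommRing S] [CommRing A] [Algebra S A] {u v g₁ g₂ : S}
    (hsurj : Function.Surjective (algebraMap S A))
    (hu : algebraMap S A u = 0) (hv : algebraMap S A v = 0)
    (h0 : g₁ * u + g₂ * v = 0)
    (h1 : ∀ s, algebraMap S A s = 0 → ∃ a b, s = a * u + b * v)
    (h2 : ∀ c₁ c₂, c₁ * u + c₂ * v = 0 → ∃ a b, c₁ = a * g₁ - b * v ∧ c₂ = a * g₂ + b * u)
    (h3 : ∀ a b, a * g₁ - b * v = 0 → a * g₂ + b * u = 0 →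
      ∃ c₁ c₂, a = c₁ * u + c₂ * v ∧ b = c₂ * g₁ - c₁ * g₂) :
    IsResolution (N := fun n => Fin (mfRank n) → S) (fun n => (mfD u v g₁ g₂ n).mulVecLin)
      (Algebra.linearMap S A ∘ₗ LinearMap.proj (0 : Fin 1)) where
  surjective a := by
    obtain ⟨s, rfl⟩ := hsurj a
    exact ⟨fun _ => s, rfl⟩
  exact_zero := by
    change Function.Exact (!![u, v] : Matrix (Fin 1) (Fin 2) S).mulVecLin
      (Algebra.linearMap S A ∘ₗ LinearMap.proj (0 : Fin 1))
    intro x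
    constructor
    · intro h
      obtain ⟨a, b, hab⟩ := h1 (x 0) h
      refine ⟨![a, b], ?_⟩
      rw [mulVecLin_fin_one_two]
      ext i; fin_cases i
      simp [hab]; ring
    · rintro ⟨y, rfl⟩
      simp [hu, hv]
  exact_succ n := by
    have key2 : ∀ x : Fin 2 → S, x 0 * u + x 1 * v = 0 →
        ∃ y, (!![g₁, -v; g₂, u]).mulVecLin y = x := fun x hx => by
      obtain ⟨a, b, ha, hb⟩ := h2 (x 0) (x 1) hx
      refine ⟨![a, b], ?_⟩
      rw [mulVecLin_fin_two]
      ext i; fin_cases i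
      · simp [ha]; ring
      · simp [hb]; ring
    cases n with
    | zero =>
      rw [mfD_odd _ _ _ _ 0 ⟨0, rfl⟩]
      change Function.Exact (!![g₁, -v; g₂, u]).mulVecLin
        (!![u, v] : Matrix (Fin 1) (Fin 2) S).mulVecLin
      intro x
      rw [mulVecLin_fin_one_two]
      constructor
      · intro h
        have e0 := congrFun h 0
        simp at e0
        exact key2 x (by linear_combination e0)
      · rintro ⟨y, rfl⟩
        rw [mulVecLin_fin_two]
        ext i; fin_cases i
        simp; linear_combination y 0 * h0
    | succ n =>
      by_cases hn : Even n
      · rw [mfD_even _ _ _ _ (n + 1) (by simp [hn, Nat.even_add_one]), mfD_odd _ _ _ _ n hn]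
        change Function.Exact (!![u, v; -g₂, g₁]).mulVecLin (!![g₁, -v; g₂, u]).mulVecLin
        intro x
        rw [mulVecLin_fin_two]
        constructor
        · intro h
          have e0 := congrFun h 0
          have e1 := congrFun h 1
          simp at e0 e1
          obtain ⟨a, b, ha, hb⟩ := h3 (x 0) (x 1) (by linear_combination e0)
            (by linear_combination e1)
          refine ⟨![a, b], ?_⟩
          rw [mulVecLin_fin_two]
          ext i; fin_cases i
          · simp [ha]; ring
          · simp [hb]; ring
        · rintro ⟨y, rfl⟩
          rw [mulVecLin_fin_two]
          ext i; fin_cases i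
          · simp; linear_combination y 0 * h0
          · simp; linear_combination y 1 * h0
      · rw [mfD_odd _ _ _ _ (n + 1) (by simp [hn, Nat.even_add_one]), mfD_even _ _ _ _ n hn]
        change Function.Exact (!![g₁, -v; g₂, u]).mulVecLin (!![u, v; -g₂, g₁]).mulVecLin
        intro x
        rw [mulVecLin_fin_two]
        constructor
        · intro h
          have e0 := congrFun h 0
          simp at e0
          exact key2 x (by linear_combination e0)
        · rintro ⟨y, rfl⟩
          rw [mulVecLin_fin_two]
          ext i; fin_cases i
          · simp; linear_combination y 0 * h0
          · simp; linear_combination y 1 * h0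

end MatrixFactorization

section Hypersurface

variable {k : Type*} [Field k] {f : MvPolynomial (Fin 2) k}

theorem exists_isResolution_curve (hf : f ≠ 0) : ∃ u v g₁ g₂ : Env k (Curve f),
    Env.mul k (Curve f) u = 0 ∧ Env.mul k (Curve f) v = 0 ∧
    Env.mul k (Curve f) g₁ = Ideal.Quotient.mk _ (pderiv 0 f) ∧
    Env.mul k (Curve f) g₂ = Ideal.Quotient.mk _ (pderiv 1 f) ∧
    IsResolution (N := fun n => Fin (mfRank n) → Env k (Curve f))
      (fun n => (mfD u v g₁ g₂ n).mulVecLin)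
      (Algebra.linearMap (Env k (Curve f)) (Curve f) ∘ₗ LinearMap.proj (0 : Fin 1)) := by
  set F := map (algebraMap k (Curve f)) f with hF
  have evalF : ∀ p, eval (coord f) (map (algebraMap k (Curve f)) p) = Ideal.Quotient.mk _ p :=
    fun p => by rw [eval_map, ← aeval_def, aeval_coord]
  have hF0 : eval (coord f) F = 0 := by
    rw [evalF, Ideal.Quotient.eq_zero_iff_mem]
    exact Ideal.mem_span_singleton_self f
  have θF : polyToEnv f F = 0 := by
    rw [polyToEnv_map, Ideal.Quotient.eq_zero_iff_mem.2 (Ideal.mem_span_singleton_self f), map_zero]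
  have reg : ∀ p, F * p = 0 → p = 0 := fun p => eq_zero_of_map_mul_eq_zero hf
  obtain ⟨g₁, g₂, hg⟩ := exists_of_eval_eq_zero (coord f) hF0
  set U : MvPolynomial (Fin 2) (Curve f) := X 0 - C (coord f 0)
  set V : MvPolynomial (Fin 2) (Curve f) := X 1 - C (coord f 1)
  have hU : eval (coord f) U = 0 := by simp [U]
  have hV : eval (coord f) V = 0 := by simp [V]
  refine ⟨polyToEnv f U, polyToEnv f V, polyToEnv f g₁, polyToEnv f g₂, ?_, ?_, ?_, ?_, ?_⟩
  · rw [mul_polyToEnv, hU]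
  · rw [mul_polyToEnv, hV]
  -- Differentiate `F = g₁ U + g₂ V` at the point `x`: terms retaining a factor `U` or `V` vanish
  -- there, leaving `g₁`.
  · rw [mul_polyToEnv, ← evalF, ← pderiv_map, ← hF, hg, map_add, Derivation.leibniz,
      Derivation.leibniz]
    simp [U, V, pderiv_X]
  · rw [mul_polyToEnv, ← evalF, ← pderiv_map, ← hF, hg, map_add, Derivation.leibniz,
      Derivation.leibniz]
    simp [U, V, pderiv_X]
  refine isResolution_mfD (fun a => ⟨Env.inl k _ a, Env.mul_inl a⟩)
    ?_ ?_ ?_ ?_ ?_ ?_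
  · rw [Env.algebraMap_apply, mul_polyToEnv, hU]
  · rw [Env.algebraMap_apply, mul_polyToEnv, hV]
  · rw [← map_mul, ← map_mul, ← map_add, ← hg, θF]
  · intro s hs
    obtain ⟨p, rfl⟩ := polyToEnv_surjective f s
    rw [Env.algebraMap_apply, mul_polyToEnv] at hs
    obtain ⟨a, b, rfl⟩ := exists_of_eval_eq_zero (coord f) hs
    exact ⟨polyToEnv f a, polyToEnv f b, by simp [U, V]⟩
  · intro c₁ c₂ h
    obtain ⟨c₁, rfl⟩ := polyToEnv_surjective f c₁
    obtain ⟨c₂, rfl⟩ := polyToEnv_surjective f c₂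
    simp only [← map_mul, ← map_add] at h
    obtain ⟨q, hq⟩ := dvd_of_polyToEnv_eq_zero f h
    -- The relation lifts to `c₁ U + c₂ V = F q`; subtracting `q` times `F = g₁ U + g₂ V` leaves a
    -- Koszul relation.
    obtain ⟨b, h1, h2⟩ := koszul_exact (coord f) (c₁ := c₁ - q * g₁) (c₂ := c₂ - q * g₂) (by
      linear_combination hq + q * hg)
    refine ⟨polyToEnv f q, polyToEnv f b, ?_, ?_⟩
    · rw [← map_mul, ← map_mul, ← map_sub]; congr 1; linear_combination h1
    · rw [← map_mul, ← map_mul, ← map_add]; congr 1; linear_combination h2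
  · intro a b ha hb
    obtain ⟨a, rfl⟩ := polyToEnv_surjective f a
    obtain ⟨b, rfl⟩ := polyToEnv_surjective f b
    simp only [← map_mul, ← map_add, ← map_sub] at ha hb
    obtain ⟨q, hq⟩ := dvd_of_polyToEnv_eq_zero f ha
    obtain ⟨r, hr⟩ := dvd_of_polyToEnv_eq_zero f hb
    -- Applying the other matrix of the factorization multiplies `(a, b)` by `F`, and `F` is a
    -- non-zero-divisor.
    have e1 : a = q * U + r * V := by
      refine sub_eq_zero.1 (reg _ ?_)
      linear_combination a * hg + U * hq + V * hr
    have e2 : b = r * g₁ - q * g₂ := by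
      refine sub_eq_zero.1 (reg _ ?_)
      linear_combination b * hg + g₁ * hr - g₂ * hq
    refine ⟨polyToEnv f q, polyToEnv f r, ?_, ?_⟩
    · rw [e1]; simp
    · rw [e2]; simp

end Hypersurface

end Hochschild

/-! ### The periodic subquotients are the Jacobian algebra. -/

/-- A linear map that hits every class of a subquotient identifies it with a quotient of its
source. -/
theorem Submodule.nonempty_subquotient_equiv {k A X R : Type*} [CommRing k] [CommRing A]
    [Algebra k A] [AddCommGroup X] [Module A X] [Module k X] [IsScalarTower k A X]
    [CommRing R] [Algebra k R] {Z B : Submodule A X} {J : Ideal R} (Φ : R →ₗ[k] X)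
    (hZ : ∀ r, Φ r ∈ Z) (hsurj : ∀ z ∈ Z, ∃ r, Φ r - z ∈ B) (hB : ∀ r, Φ r ∈ B ↔ r ∈ J) :
    Nonempty ((R ⧸ J) ≃ₗ[k] (Z ⧸ B.submoduleOf Z)) := by
  let Ψ : R →ₗ[k] (Z ⧸ B.submoduleOf Z) :=
    ((B.submoduleOf Z).mkQ.restrictScalars k) ∘ₗ
      (Φ.codRestrict (Z.restrictScalars k) hZ : R →ₗ[k] Z)
  have hker : (J.restrictScalars k : Submodule k R) = LinearMap.ker Ψ := by
    ext r
    rw [Submodule.restrictScalars_mem, ← hB]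
    exact (Submodule.Quotient.mk_eq_zero (B.submoduleOf Z) (x := ⟨Φ r, hZ r⟩)).symm
  have hs : Function.Surjective Ψ := fun y => by
    obtain ⟨z, rfl⟩ := Submodule.Quotient.mk_surjective _ y
    obtain ⟨r, hr⟩ := hsurj z z.2
    exact ⟨r, (Submodule.Quotient.eq (B.submoduleOf Z) (x := ⟨Φ r, hZ r⟩)).2 hr⟩
  exact ⟨(Submodule.Quotient.restrictScalarsEquiv k J).symm ≪≫ₗ
    Submodule.quotEquivOfEq _ _ hker ≪≫ₗ Ψ.quotKerEquivOfSurjective hs⟩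

/-- The chosen section is only `k`-linear, but the equivalence restricts to `i` itself; linearity of
`i` over a larger ring is therefore kept on that summand. -/
theorem LinearMap.exists_prod_equiv_of_exact {k X Y V : Type*} [Field k] [AddCommGroup X]
    [AddCommGroup Y] [AddCommGroup V] [Module k X] [Module k Y] [Module k V]
    (i : X →ₗ[k] Y) (π : Y →ₗ[k] V) (hi : Function.Injective i) (hπ : Function.Surjective π)
    (h : Function.Exact i π) : ∃ e : (X × V) ≃ₗ[k] Y, ∀ x, e (x, 0) = i x := by
  obtain ⟨s, hs⟩ := π.exists_rightInverse_of_surjective (LinearMap.range_eq_top.2 hπ)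
  have hs' : ∀ v, π (s v) = v := fun v => LinearMap.congr_fun hs v
  suffices hb : Function.Bijective (i.coprod s) from
    ⟨LinearEquiv.ofBijective (i.coprod s) hb, fun x => by simp⟩
  refine ⟨?_, fun y => ?_⟩
  · rw [← LinearMap.ker_eq_bot, LinearMap.ker_eq_bot']
    rintro ⟨x, v⟩ hxv
    have hv : v = 0 := by
      have := congrArg π hxv
      simpa [hs', h.apply_apply_eq_zero] using this
    subst hv
    have : i x = 0 := by simpa using hxv
    rw [(map_eq_zero_iff i hi).1 this]; rfl
  · obtain ⟨x, hx⟩ := (h (y - s (π y))).1 (by simp [hs'])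
    exact ⟨(x, π y), by simp [hx]⟩

namespace Hochschild

open MvPolynomial

/-- The hypotheses on a plane curve under which its Hochschild (co)homology is computed: the
partial derivatives are nowhere proportional, and `f` is a combination of them. -/
structure IsolatedEuler {k : Type*} [Field k] (f e₁ e₂ : MvPolynomial (Fin 2) k) : Prop where
  ne_zero : f ≠ 0
  euler : f = e₁ * pderiv 0 f + e₂ * pderiv 1 f
  rel : ∀ a b, a * pderiv 0 f = b * pderiv 1 f → ∃ c, a = c * pderiv 1 f ∧ b = c * pderiv 0 f

/-- The projection onto the coordinate ring of a plane curve. -/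
noncomputable abbrev toCurve {k : Type*} [Field k] (f : MvPolynomial (Fin 2) k) :
    MvPolynomial (Fin 2) k →+* Curve f :=
  Ideal.Quotient.mk (Ideal.span {f})

/-- The ideal generated by the partial derivatives. -/
noncomputable def jacobianIdeal {k : Type*} [Field k] (f : MvPolynomial (Fin 2) k) :
    Ideal (MvPolynomial (Fin 2) k) := Ideal.span {pderiv 0 f, pderiv 1 f}

namespace IsolatedEuler

variable {k : Type*} [Field k] {f e₁ e₂ : MvPolynomial (Fin 2) k} 

theorem mk_eq_iff {a b : MvPolynomial (Fin 2) k} :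
    toCurve f a = toCurve f b ↔ ∃ c, a - b = f * c := by
  rw [Ideal.Quotient.eq, Ideal.mem_span_singleton]; rfl

theorem mk_self : toCurve f f = 0 :=
  Ideal.Quotient.eq_zero_iff_mem.2 (Ideal.mem_span_singleton_self f)

theorem mk_euler (H : IsolatedEuler f e₁ e₂) :
    toCurve f e₁ * toCurve f (pderiv 0 f) + toCurve f e₂ * toCurve f (pderiv 1 f) = 0 := by
  rw [← map_mul, ← map_mul, ← map_add, ← H.euler, mk_self]

/-- If `a` times the gradient is `f (s, t)`, then `rel` makes `(s, t)` a multiple `c` of the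
gradient. Pairing with `(e₁, e₂)` gives `f a = f (f c)`, so `a = f c`. -/
theorem eq_zero_of_mul (H : IsolatedEuler f e₁ e₂) {a : Curve f} (h1 : a * toCurve f (pderiv 0 f) = 0)
    (h2 : a * toCurve f (pderiv 1 f) = 0) : a = 0 := by
  obtain ⟨a, rfl⟩ := Ideal.Quotient.mk_surjective a
  rw [← map_mul, ← map_zero (toCurve f), mk_eq_iff, sub_zero] at h1 h2
  obtain ⟨s, hs⟩ := h1
  obtain ⟨t, ht⟩ := h2
  obtain ⟨c, rfl, rfl⟩ := H.rel t s (mul_left_cancel₀ H.ne_zero (by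
    linear_combination pderiv 1 f * hs - pderiv 0 f * ht))
  rw [← map_zero (toCurve f), mk_eq_iff]
  refine ⟨c, sub_eq_zero.1 (mul_left_cancel₀ H.ne_zero ?_)⟩
  have h := H.euler
  linear_combination (a - f * c) * h + e₁ * hs + e₂ * ht

/-- The relation holds up to a multiple `f r`. Writing `f` through its partial derivatives absorbs
this into the Euler vector, and `rel` applies to what remains. -/
theorem exists_of_mul_eq (H : IsolatedEuler f e₁ e₂) {c₁ c₂ : Curve f}
    (h : c₁ * toCurve f (pderiv 1 f) = c₂ * toCurve f (pderiv 0 f)) :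
    ∃ t r, c₁ = toCurve f t * toCurve f (pderiv 0 f) + toCurve f r * toCurve f e₂ ∧
      c₂ = toCurve f t * toCurve f (pderiv 1 f) - toCurve f r * toCurve f e₁ := by
  obtain ⟨c₁, rfl⟩ := Ideal.Quotient.mk_surjective c₁
  obtain ⟨c₂, rfl⟩ := Ideal.Quotient.mk_surjective c₂
  rw [← map_mul, ← map_mul, mk_eq_iff] at h
  obtain ⟨r, hr⟩ := h
  obtain ⟨c, h1, h2⟩ := H.rel (c₂ + r * e₁) (c₁ - r * e₂) (by
    linear_combination -hr - r * H.euler)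
  refine ⟨c, r, ?_, ?_⟩
  · rw [← map_mul, ← map_mul, ← map_add]; congr 1; linear_combination h2
  · rw [← map_mul, ← map_mul, ← map_sub]; congr 1; linear_combination h1

/-- Since `f` lies in the Jacobian ideal, membership can be tested on the curve. -/
theorem mem_jacobianIdeal_iff (H : IsolatedEuler f e₁ e₂) {r : MvPolynomial (Fin 2) k} :
    r ∈ jacobianIdeal f ↔ ∃ a b : Curve f,
      a * toCurve f (pderiv 0 f) + b * toCurve f (pderiv 1 f) = toCurve f r := by
  rw [jacobianIdeal, Ideal.mem_span_pair]
  constructor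
  · rintro ⟨a, b, rfl⟩
    exact ⟨toCurve f a, toCurve f b, by simp⟩
  · rintro ⟨a, b, h⟩
    obtain ⟨a, rfl⟩ := Ideal.Quotient.mk_surjective a
    obtain ⟨b, rfl⟩ := Ideal.Quotient.mk_surjective b
    rw [← map_mul, ← map_mul, ← map_add, mk_eq_iff] at h
    obtain ⟨c, hc⟩ := h
    exact ⟨a - c * e₁, b - c * e₂, by linear_combination hc + c * H.euler⟩

/-- The Jacobian ideal is the annihilator of the Euler vector `(e₂, -e₁)` modulo the gradient.
Conversely, eliminating `t` from lifts of both equations gives `f r` as `f` times a combination of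
the partial derivatives. -/
theorem mem_jacobianIdeal_iff' (H : IsolatedEuler f e₁ e₂) {r : MvPolynomial (Fin 2) k} :
    r ∈ jacobianIdeal f ↔ ∃ t : Curve f, t * toCurve f (pderiv 0 f) = toCurve f r * toCurve f e₂ ∧
      t * toCurve f (pderiv 1 f) = -(toCurve f r * toCurve f e₁) := by
  constructor
  · intro h
    obtain ⟨a, b, rfl⟩ := Ideal.mem_span_pair.1 h
    refine ⟨toCurve f a * toCurve f e₂ - toCurve f b * toCurve f e₁, ?_, ?_⟩
    · simp only [map_add, map_mul]
      linear_combination -toCurve f b * H.mk_euler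
    · simp only [map_add, map_mul]
      linear_combination toCurve f a * H.mk_euler
  · rintro ⟨t, h1, h2⟩
    obtain ⟨t, rfl⟩ := Ideal.Quotient.mk_surjective t
    rw [← map_mul, ← map_mul, mk_eq_iff] at h1
    rw [← map_mul, ← map_mul, ← map_neg, mk_eq_iff] at h2
    obtain ⟨α, hα⟩ := h1
    obtain ⟨β, hβ⟩ := h2
    refine Ideal.mem_span_pair.2 ⟨β, -α, mul_left_cancel₀ H.ne_zero ?_⟩
    linear_combination pderiv 1 f * hα - pderiv 0 f * hβ - r * H.euler

/-- A pair of polynomials as a linear map into pairs of functions on the curve. -/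
noncomputable def pairMap (a b : MvPolynomial (Fin 2) k) :
    MvPolynomial (Fin 2) k →ₗ[k] (Fin 2 → Curve f) where
  toFun r := ![toCurve f r * toCurve f a, toCurve f r * toCurve f b]
  map_add' r s := by ext i; fin_cases i <;> simp [add_mul]
  map_smul' c r := by
    ext i
    fin_cases i <;> simp [← smul_eq_mul, ← smul_assoc] <;> rfl

theorem pairMap_apply (a b r : MvPolynomial (Fin 2) k) :
    pairMap (f := f) a b r = ![toCurve f r * toCurve f a, toCurve f r * toCurve f b] := rfl

theorem mem_ker_fin_two {S : Type*} [CommRing S] {a b c d : S} {x : Fin 2 → S} :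
    x ∈ LinearMap.ker (!![a, b; c, d]).mulVecLin ↔
      a * x 0 + b * x 1 = 0 ∧ c * x 0 + d * x 1 = 0 := by
  rw [LinearMap.mem_ker, mulVecLin_fin_two, funext_iff, Fin.forall_fin_two]; rfl

theorem mem_range_fin_two {S : Type*} [CommRing S] {a b c d : S} {x : Fin 2 → S} :
    x ∈ LinearMap.range (!![a, b; c, d]).mulVecLin ↔
      ∃ s t, a * s + b * t = x 0 ∧ c * s + d * t = x 1 := by
  constructor
  · rintro ⟨y, rfl⟩
    rw [mulVecLin_fin_two]
    exact ⟨y 0, y 1, rfl, rfl⟩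
  · rintro ⟨s, t, h1, h2⟩
    refine ⟨![s, t], ?_⟩
    rw [mulVecLin_fin_two]
    ext i; fin_cases i
    · exact h1
    · exact h2

/-- A cycle has first entry killed by both partial derivatives, hence zero; its second entry is free
and matters modulo the Jacobian ideal. -/
theorem homology_even (H : IsolatedEuler f e₁ e₂) :
    Nonempty ((MvPolynomial (Fin 2) k ⧸ jacobianIdeal f) ≃ₗ[k]
      (LinearMap.ker (!![toCurve f (pderiv 0 f), 0; toCurve f (pderiv 1 f), 0]).mulVecLin ⧸
        (LinearMap.range (!![0, 0; -toCurve f (pderiv 1 f), toCurve f (pderiv 0 f)]).mulVecLin).submoduleOf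
          (LinearMap.ker (!![toCurve f (pderiv 0 f), 0; toCurve f (pderiv 1 f), 0]).mulVecLin))) := by
  refine Submodule.nonempty_subquotient_equiv (k := k) (pairMap (f := f) 0 1) (fun r => ?_) (fun z hz => ?_)
    fun r => ?_
  · rw [mem_ker_fin_two, pairMap_apply]; simp
  · rw [mem_ker_fin_two] at hz
    have h0 : z 0 = 0 := H.eq_zero_of_mul (by linear_combination hz.1) (by linear_combination hz.2)
    obtain ⟨r, hr⟩ := Ideal.Quotient.mk_surjective (z 1)
    refine ⟨r, ?_⟩
    have : pairMap (f := f) 0 1 r - z = 0 := by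
      rw [pairMap_apply]
      ext i; fin_cases i
      · simp [h0]
      · simp [hr]
    rw [this]; exact zero_mem _
  · rw [mem_range_fin_two, pairMap_apply, H.mem_jacobianIdeal_iff]
    constructor
    · rintro ⟨s, t, -, h⟩
      simp at h
      exact ⟨t, -s, by linear_combination h⟩
    · rintro ⟨a, b, h⟩
      exact ⟨-b, a, by simp, by simp; linear_combination h⟩

/-- Cycles are generated by the gradient, which bounds, and the Euler vector `(e₂, -e₁)`. -/
theorem homology_odd (H : IsolatedEuler f e₁ e₂) :
    Nonempty ((MvPolynomial (Fin 2) k ⧸ jacobianIdeal f) ≃ₗ[k]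
      (LinearMap.ker (!![0, 0; -toCurve f (pderiv 1 f), toCurve f (pderiv 0 f)]).mulVecLin ⧸
        (LinearMap.range (!![toCurve f (pderiv 0 f), 0; toCurve f (pderiv 1 f), 0]).mulVecLin).submoduleOf
          (LinearMap.ker (!![0, 0; -toCurve f (pderiv 1 f), toCurve f (pderiv 0 f)]).mulVecLin))) := by
  refine Submodule.nonempty_subquotient_equiv (k := k) (pairMap (f := f) e₂ (-e₁))
    (fun r => ?_) (fun z hz => ?_)
    fun r => ?_
  · rw [mem_ker_fin_two, pairMap_apply]
    refine ⟨by simp, ?_⟩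
    simp
    linear_combination -toCurve f r * H.mk_euler
  · rw [mem_ker_fin_two] at hz
    obtain ⟨t, r, h1, h2⟩ := H.exists_of_mul_eq (c₁ := z 0) (c₂ := z 1) (by
      linear_combination -hz.2)
    refine ⟨r, ?_⟩
    rw [mem_range_fin_two, pairMap_apply]
    refine ⟨-toCurve f t, 0, ?_, ?_⟩
    · simp [h1]; ring
    · simp [h2]; ring
  · rw [mem_range_fin_two, pairMap_apply, H.mem_jacobianIdeal_iff']
    constructor
    · rintro ⟨s, t, h, h'⟩
      simp at h h'
      exact ⟨s, by linear_combination h, by linear_combination h'⟩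
    · rintro ⟨t, h, h'⟩
      exact ⟨t, 0, by simp; linear_combination h, by simp; linear_combination h'⟩

theorem cohomology_even (H : IsolatedEuler f e₁ e₂) :
    Nonempty ((MvPolynomial (Fin 2) k ⧸ jacobianIdeal f) ≃ₗ[k]
      (LinearMap.ker (!![0, -toCurve f (pderiv 1 f); 0, toCurve f (pderiv 0 f)]).mulVecLin ⧸
        (LinearMap.range (!![toCurve f (pderiv 0 f), toCurve f (pderiv 1 f); 0, 0]).mulVecLin).submoduleOf
          (LinearMap.ker (!![0, -toCurve f (pderiv 1 f); 0, toCurve f (pderiv 0 f)]).mulVecLin))) := by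
  refine Submodule.nonempty_subquotient_equiv (k := k) (pairMap (f := f) 1 0) (fun r => ?_) (fun z hz => ?_)
    fun r => ?_
  · rw [mem_ker_fin_two, pairMap_apply]; simp
  · rw [mem_ker_fin_two] at hz
    have h0 : z 1 = 0 := H.eq_zero_of_mul (by linear_combination hz.2) (by linear_combination -hz.1)
    obtain ⟨r, hr⟩ := Ideal.Quotient.mk_surjective (z 0)
    refine ⟨r, ?_⟩
    have : pairMap (f := f) 1 0 r - z = 0 := by
      rw [pairMap_apply]
      ext i; fin_cases i
      · simp [hr]
      · simp [h0]
    rw [this]; exact zero_mem _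
  · rw [mem_range_fin_two, pairMap_apply, H.mem_jacobianIdeal_iff]
    constructor
    · rintro ⟨s, t, h, -⟩
      simp at h
      exact ⟨s, t, by linear_combination h⟩
    · rintro ⟨a, b, h⟩
      exact ⟨a, b, by simp; linear_combination h, by simp⟩

theorem cohomology_odd (H : IsolatedEuler f e₁ e₂) :
    Nonempty ((MvPolynomial (Fin 2) k ⧸ jacobianIdeal f) ≃ₗ[k]
      (LinearMap.ker (!![toCurve f (pderiv 0 f), toCurve f (pderiv 1 f); 0, 0]).mulVecLin ⧸
        (LinearMap.range (!![0, -toCurve f (pderiv 1 f); 0, toCurve f (pderiv 0 f)]).mulVecLin).submoduleOf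
          (LinearMap.ker (!![toCurve f (pderiv 0 f), toCurve f (pderiv 1 f); 0, 0]).mulVecLin))) := by
  refine Submodule.nonempty_subquotient_equiv (k := k) (pairMap (f := f) e₁ e₂)
    (fun r => ?_) (fun z hz => ?_)
    fun r => ?_
  · rw [mem_ker_fin_two, pairMap_apply]
    refine ⟨?_, by simp⟩
    simp
    linear_combination toCurve f r * H.mk_euler
  · rw [mem_ker_fin_two] at hz
    obtain ⟨t, r, h1, h2⟩ := H.exists_of_mul_eq (c₁ := z 1) (c₂ := -z 0) (by
      linear_combination hz.1)
    refine ⟨r, ?_⟩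
    rw [mem_range_fin_two, pairMap_apply]
    refine ⟨0, -toCurve f t, ?_, ?_⟩
    · simp; linear_combination -h2
    · simp [h1]; ring
  · rw [mem_range_fin_two, pairMap_apply, H.mem_jacobianIdeal_iff']
    constructor
    · rintro ⟨s, t, h, h'⟩
      simp at h h'
      exact ⟨t, by linear_combination h', by linear_combination -h⟩
    · rintro ⟨t, h, h'⟩
      exact ⟨0, t, by simp; linear_combination -h', by simp; linear_combination h⟩

end IsolatedEuler

end Hochschild

/-! ### Hochschild (co)homology of a plane curve, degree by degree. -/

namespace Submodule

variable {A X : Type*} [CommRing A] [AddCommGroup X] [Module A X]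

/-- A quotient of the top submodule. -/
noncomputable def topSubquotientEquiv (B : Submodule A X) :
    ((⊤ : Submodule A X) ⧸ B.submoduleOf ⊤) ≃ₗ[A] X ⧸ B :=
  Submodule.Quotient.equiv _ _ Submodule.topEquiv (by
    rw [Submodule.submoduleOf]
    ext x
    simp)

/-- The quotient of a submodule by the zero submodule. -/
noncomputable def botSubquotientEquiv (Z : Submodule A X) :
    (Z ⧸ (⊥ : Submodule A X).submoduleOf Z) ≃ₗ[A] Z :=
  Submodule.quotEquivOfEqBot _ (by rw [Submodule.submoduleOf, Submodule.comap_bot, Z.ker_subtype])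

theorem exists_prod_equiv_of_subquotient {k Y V : Type*} [Field k] [Algebra k A] [Module k X]
    [IsScalarTower k A X] [AddCommGroup Y] [Module A Y] [Module k Y] [IsScalarTower k A Y]
    [AddCommGroup V] [Module k V] {Z B : Submodule A X} (i : Y →ₗ[A] X)
    (hi : Function.Injective i) (hB : ∀ x, x ∈ B ↔ x ∈ LinearMap.range i) (hZ : ∀ y, i y ∈ Z)
    (φ : (Z ⧸ B.submoduleOf Z) ≃ₗ[k] V) :
    ∃ (i' : Y →ₗ[A] Z) (e : (Y × V) ≃ₗ[k] Z), ∀ y, e (y, 0) = i' y := by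
  let i' : Y →ₗ[A] Z := i.codRestrict Z hZ
  let π : Z →ₗ[k] V := φ.toLinearMap ∘ₗ ((B.submoduleOf Z).mkQ.restrictScalars k)
  have hi' : Function.Injective (i'.restrictScalars k) := fun a b hab =>
    hi (congrArg (fun z : Z => (z : X)) hab)
  have hπ : Function.Surjective π := fun v => by
    obtain ⟨z, hz⟩ := Submodule.mkQ_surjective (B.submoduleOf Z) (φ.symm v)
    refine ⟨z, ?_⟩
    change φ ((B.submoduleOf Z).mkQ z) = v
    rw [hz, LinearEquiv.apply_symm_apply]
  have h0 : ∀ z, π z = 0 ↔ (z : X) ∈ B := fun z => by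
    change φ ((B.submoduleOf Z).mkQ z) = 0 ↔ _
    rw [LinearEquiv.map_eq_zero_iff]
    exact Submodule.Quotient.mk_eq_zero (B.submoduleOf Z)
  have hex : Function.Exact (i'.restrictScalars k) π := fun z => by
    rw [h0, hB]
    constructor
    · rintro ⟨y, hy⟩
      exact ⟨y, Subtype.ext hy⟩
    · rintro ⟨y, rfl⟩
      exact ⟨y, rfl⟩
  obtain ⟨e, he⟩ := LinearMap.exists_prod_equiv_of_exact (i'.restrictScalars k) π hi' hπ hex
  exact ⟨i', e, he⟩

end Submodule

namespace Hochschild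

open MvPolynomial

theorem mfD_zero_zero {S : Type*} [CommRing S] (g₁ g₂ : S) : mfD 0 0 g₁ g₂ 0 = 0 := by
  refine Matrix.ext fun i j => ?_
  change (!![0, 0] : Matrix (Fin 1) (Fin 2) S) i j = 0
  fin_cases i; fin_cases j <;> rfl

theorem mfD_zero_odd {S : Type*} [CommRing S] (g₁ g₂ : S) (n : ℕ) (hn : Even n) :
    mfD 0 0 g₁ g₂ (n + 1) = (!![g₁, 0; g₂, 0] : Matrix (Fin 2) (Fin 2) S) := by
  rw [mfD_odd _ _ _ _ n hn, neg_zero]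

theorem mfD_zero_odd_transpose {S : Type*} [CommRing S] (g₁ g₂ : S) (n : ℕ) (hn : Even n) :
    (mfD 0 0 g₁ g₂ (n + 1)).transpose = (!![g₁, g₂; 0, 0] : Matrix (Fin 2) (Fin 2) S) := by
  rw [mfD_zero_odd _ _ n hn]
  refine Matrix.ext fun i j => ?_
  revert i j
  change ∀ i j : Fin 2, (!![g₁, 0; g₂, 0]).transpose i j = !![g₁, g₂; 0, 0] i j
  simp [Fin.forall_fin_two]

theorem mfD_zero_even_transpose {S : Type*} [CommRing S] (g₁ g₂ : S) (n : ℕ) (hn : ¬ Even n) :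
    (mfD 0 0 g₁ g₂ (n + 1)).transpose = (!![0, -g₂; 0, g₁] : Matrix (Fin 2) (Fin 2) S) := by
  rw [mfD_even _ _ _ _ n hn]
  refine Matrix.ext fun i j => ?_
  revert i j
  change ∀ i j : Fin 2, (!![0, 0; -g₂, g₁]).transpose i j = !![0, -g₂; 0, g₁] i j
  simp [Fin.forall_fin_two]

theorem range_mulVecLin_zero {S : Type*} [CommRing S] (m n : ℕ) :
    LinearMap.range (0 : Matrix (Fin m) (Fin n) S).mulVecLin = ⊥ := by
  rw [Matrix.mulVecLin_zero, LinearMap.range_zero]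

theorem ker_mulVecLin_zero {S : Type*} [CommRing S] (m n : ℕ) :
    LinearMap.ker (0 : Matrix (Fin m) (Fin n) S).mulVecLin = ⊤ := by
  rw [Matrix.mulVecLin_zero, LinearMap.ker_zero]

theorem range_mulVecLin_eq_span {S : Type*} [CommRing S] (x : Fin 2 → S) :
    LinearMap.range (!![x 0, 0; x 1, 0]).mulVecLin = Submodule.span S {x} := by
  ext y
  rw [Submodule.mem_span_singleton]
  refine IsolatedEuler.mem_range_fin_two.trans ?_
  constructor
  · rintro ⟨s, t, h1, h2⟩
    refine ⟨s, funext fun i => ?_⟩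
    fin_cases i
    · simp [← h1, mul_comm]
    · simp [← h2, mul_comm]
  · rintro ⟨s, rfl⟩
    exact ⟨s, 0, by simp [mul_comm], by simp [mul_comm]⟩

section

variable {k : Type*} [Field k] {f e₁ e₂ : MvPolynomial (Fin 2) k}

theorem exists_isResolution_curve_map (hf : f ≠ 0) :
    ∃ (d : ∀ n, Matrix (Fin (mfRank n)) (Fin (mfRank (n + 1))) (Env k (Curve f)))
      (ε : (Fin (mfRank 0) → Env k (Curve f)) →ₗ[Env k (Curve f)] Curve f),
      IsResolution (N := fun n => Fin (mfRank n) → Env k (Curve f)) (fun n => (d n).mulVecLin) ε ∧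
      ∀ n, (d n).map (Env.mul k (Curve f)) =
        mfD 0 0 (toCurve f (pderiv 0 f)) (toCurve f (pderiv 1 f)) n := by
  obtain ⟨u, v, g₁, g₂, hu, hv, h1, h2, h⟩ := exists_isResolution_curve hf
  exact ⟨_, _, h, fun n => by rw [mfD_map, hu, hv, h1, h2]⟩

theorem cohomology_zero_curve (hf : f ≠ 0) :
    Nonempty (Cohomology k (Curve f) 0 ≃ₗ[Curve f] Curve f) := by
  obtain ⟨d, ε, h, hd⟩ := exists_isResolution_curve_map hf
  obtain ⟨e⟩ := cohomology_zero_of_isResolution h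
  rw [hd, mfD_zero_zero, Matrix.transpose_zero, ker_mulVecLin_zero] at e
  exact ⟨e ≪≫ₗ Submodule.botSubquotientEquiv _ ≪≫ₗ Submodule.topEquiv ≪≫ₗ
    LinearEquiv.funUnique (Fin 1) _ _⟩

theorem homology_zero_curve (hf : f ≠ 0) :
    Nonempty (Homology k (Curve f) 0 ≃ₗ[Curve f] Curve f) := by
  obtain ⟨d, ε, h, hd⟩ := exists_isResolution_curve_map hf
  obtain ⟨e⟩ := homology_zero_of_isResolution h
  rw [hd, mfD_zero_zero, range_mulVecLin_zero] at e
  exact ⟨e ≪≫ₗ Submodule.botSubquotientEquiv _ ≪≫ₗ Submodule.topEquiv ≪≫ₗ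
    LinearEquiv.funUnique (Fin 1) _ _⟩

theorem homology_one_curve (hf : f ≠ 0) :
    Nonempty (Homology k (Curve f) 1 ≃ₗ[Curve f]
      ((Fin 2 → Curve f) ⧸ Submodule.span (Curve f) {fun i => toCurve f (pderiv i f)})) := by
  obtain ⟨d, ε, h, hd⟩ := exists_isResolution_curve_map hf
  obtain ⟨e⟩ := homology_succ_of_isResolution h 0
  rw [hd, hd, mfD_zero_zero, ker_mulVecLin_zero, mfD_zero_odd _ _ 0 ⟨0, rfl⟩] at e
  rw [← range_mulVecLin_eq_span]
  exact ⟨e.trans (Submodule.topSubquotientEquiv _)⟩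

theorem homology_curve {m : ℕ} (H : IsolatedEuler f e₁ e₂)
    (φ : (MvPolynomial (Fin 2) k ⧸ jacobianIdeal f) ≃ₗ[k] (Fin m → k)) (n : ℕ) :
    Nonempty (Homology k (Curve f) (n + 2) ≃ₗ[k] (Fin m → k)) := by
  obtain ⟨d, ε, h, hd⟩ := exists_isResolution_curve_map H.ne_zero
  obtain ⟨e⟩ := homology_succ_of_isResolution h (n + 1)
  rw [hd, hd] at e
  by_cases hn : Even n
  · rw [mfD_zero_odd _ _ n hn, mfD_even _ _ _ _ (n + 1) (by simp [hn, Nat.even_add_one])] at e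
    obtain ⟨e'⟩ := H.homology_even
    exact ⟨e.restrictScalars k ≪≫ₗ e'.symm ≪≫ₗ φ⟩
  · rw [mfD_zero_odd _ _ (n + 1) (by simp [hn, Nat.even_add_one]), mfD_even _ _ _ _ n hn] at e
    obtain ⟨e'⟩ := H.homology_odd
    exact ⟨e.restrictScalars k ≪≫ₗ e'.symm ≪≫ₗ φ⟩

theorem cohomology_curve {m : ℕ} (H : IsolatedEuler f e₁ e₂)
    (φ : (MvPolynomial (Fin 2) k ⧸ jacobianIdeal f) ≃ₗ[k] (Fin m → k)) (n : ℕ) :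
    Nonempty (Cohomology k (Curve f) (n + 2) ≃ₗ[k] (Fin m → k)) := by
  obtain ⟨d, ε, h, hd⟩ := exists_isResolution_curve_map H.ne_zero
  obtain ⟨e⟩ := cohomology_succ_of_isResolution h (n + 1)
  rw [hd, hd] at e
  by_cases hn : Even n
  · rw [mfD_zero_odd_transpose _ _ n hn,
      mfD_zero_even_transpose _ _ (n + 1) (by simp [hn, Nat.even_add_one])] at e
    obtain ⟨e'⟩ := H.cohomology_even
    exact ⟨e.restrictScalars k ≪≫ₗ e'.symm ≪≫ₗ φ⟩
  · rw [mfD_zero_odd_transpose _ _ (n + 1) (by simp [hn, Nat.even_add_one]),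
      mfD_zero_even_transpose _ _ n hn] at e
    obtain ⟨e'⟩ := H.cohomology_odd
    exact ⟨e.restrictScalars k ≪≫ₗ e'.symm ≪≫ₗ φ⟩

theorem cohomology_one_equiv_ker (hf : f ≠ 0) :
    Nonempty (Cohomology k (Curve f) 1 ≃ₗ[Curve f] LinearMap.ker
      (!![toCurve f (pderiv 0 f), toCurve f (pderiv 1 f); 0, 0]).mulVecLin) := by
  obtain ⟨d, ε, h, hd⟩ := exists_isResolution_curve_map hf
  obtain ⟨e⟩ := cohomology_succ_of_isResolution h 0
  rw [hd, hd, mfD_zero_zero, Matrix.transpose_zero, range_mulVecLin_zero,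
    mfD_zero_odd_transpose _ _ 0 ⟨0, rfl⟩] at e
  exact ⟨e.trans (Submodule.botSubquotientEquiv _)⟩

theorem exists_equiv_ker {m : ℕ} (H : IsolatedEuler f e₁ e₂)
    (φ : (MvPolynomial (Fin 2) k ⧸ jacobianIdeal f) ≃ₗ[k] (Fin m → k)) :
    ∃ (i : Curve f →ₗ[Curve f] LinearMap.ker
        (!![toCurve f (pderiv 0 f), toCurve f (pderiv 1 f); 0, 0]).mulVecLin)
      (e : (Curve f × (Fin m → k)) ≃ₗ[k] LinearMap.ker
        (!![toCurve f (pderiv 0 f), toCurve f (pderiv 1 f); 0, 0]).mulVecLin),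
      ∀ a, e (a, 0) = i a := by
  -- The kernel modulo its Hamiltonian multiples is the subquotient that also computes the odd
  -- degrees from 3 on; in degree 1 the incoming differential is zero, so the whole kernel remains.
  obtain ⟨e'⟩ := H.cohomology_odd
  have hi : ∀ a : Curve f,
      LinearMap.toSpanSingleton (Curve f) (Fin 2 → Curve f)
        ![-toCurve f (pderiv 1 f), toCurve f (pderiv 0 f)] a =
      ![-(a * toCurve f (pderiv 1 f)), a * toCurve f (pderiv 0 f)] := fun a => by
    ext j; fin_cases j <;> simp
  refine Submodule.exists_prod_equiv_of_subquotient (LinearMap.toSpanSingleton _ _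
    ![-toCurve f (pderiv 1 f), toCurve f (pderiv 0 f)]) ?_ (fun y => ?_) ?_ (e'.symm.trans φ)
  · refine (injective_iff_map_eq_zero _).2 fun a ha => ?_
    rw [hi] at ha
    exact H.eq_zero_of_mul (congrFun ha 1) (neg_eq_zero.1 (congrFun ha 0))
  · rw [IsolatedEuler.mem_range_fin_two]
    constructor
    · rintro ⟨s, t, hs, ht⟩
      refine ⟨t, (hi t).trans (funext fun j => ?_)⟩
      fin_cases j
      · simp [← hs, mul_comm]
      · simp [← ht, mul_comm]
    · rintro ⟨t, rfl⟩
      rw [hi]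
      exact ⟨0, t, by simp [mul_comm], by simp [mul_comm]⟩
  · intro a
    rw [hi, IsolatedEuler.mem_ker_fin_two]
    simp
    ring

theorem cohomology_one_curve {m : ℕ} (H : IsolatedEuler f e₁ e₂)
    (φ : (MvPolynomial (Fin 2) k ⧸ jacobianIdeal f) ≃ₗ[k] (Fin m → k)) :
    ∃ e : (Curve f × (Fin m → k)) ≃ₗ[k] Cohomology k (Curve f) 1,
      ∀ a b : Curve f, e (a * b, 0) = a • e (b, 0) := by
  obtain ⟨E⟩ := cohomology_one_equiv_ker H.ne_zero
  obtain ⟨i, e, he⟩ := exists_equiv_ker H φ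
  refine ⟨e.trans (E.restrictScalars k).symm, fun a b => ?_⟩
  have h : ∀ x, (e.trans (E.restrictScalars k).symm) (x, 0) = E.symm (i x) := fun x =>
    congrArg E.symm (he x)
  rw [h, h, ← smul_eq_mul, i.map_smul, E.symm.map_smul]

end

end Hochschild

/-! ### Dimension of the algebras with a two-row monomial basis. -/

section TwoRowAlgebra

open Polynomial

variable (k : Type*) [Field k] (r s m : ℕ) (c : k)

/-- The ideal `(y ^ r, x * y ^ s, x ^ 2 + c * y ^ m)` of an algebra with two elements `x`, `y`. -/
def twoRowIdeal {R : Type*} [CommRing R] [Algebra k R] (x y : R) : Ideal R :=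
  Ideal.span {y ^ r, x * y ^ s, x ^ 2 + algebraMap k R c * y ^ m}

theorem mem_twoRowIdeal {R : Type*} [CommRing R] [Algebra k R] {x y p : R} :
    p ∈ twoRowIdeal k r s m c x y ↔ ∃ a b d, p = a * y ^ r + b * (x * y ^ s) +
      d * (x ^ 2 + algebraMap k R c * y ^ m) := by
  rw [twoRowIdeal, Ideal.mem_span_insert]
  constructor
  · rintro ⟨a, z, hz, rfl⟩
    obtain ⟨b, d, rfl⟩ := Ideal.mem_span_pair.1 hz
    exact ⟨a, b, d, by ring⟩
  · rintro ⟨a, b, d, rfl⟩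
    exact ⟨a, _, Ideal.mem_span_pair.2 ⟨b, d, rfl⟩, by ring⟩

/-- The quadratic polynomial `x ^ 2 + c * y ^ m`. -/
noncomputable def twoRowQuadratic : k[X][X] := X ^ 2 + C (C c * X ^ m)

theorem monic_twoRowQuadratic : (twoRowQuadratic k m c).Monic :=
  monic_X_pow_add_C _ two_ne_zero

theorem degree_twoRowQuadratic : (twoRowQuadratic k m c).degree = 2 :=
  degree_X_pow_add_C two_pos _

theorem twoRow_modByMonic (p : k[X][X]) : p %ₘ twoRowQuadratic k m c =
    C ((p %ₘ twoRowQuadratic k m c).coeff 0) + C ((p %ₘ twoRowQuadratic k m c).coeff 1) * X := by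
  conv_lhs => rw [eq_X_add_C_of_degree_le_one (p := p %ₘ twoRowQuadratic k m c)
    (Order.le_of_lt_succ (by
      have := degree_modByMonic_lt p (monic_twoRowQuadratic k m c)
      rwa [degree_twoRowQuadratic] at this))]
  ring

/-- The remainder modulo `x ^ 2 + c * y ^ m`, with its coefficients taken modulo `y ^ r` and
`y ^ s`. -/
noncomputable def twoRowMap :
    k[X][X] →ₗ[k[X]] (k[X] ⧸ Ideal.span {(X : k[X]) ^ r}) × (k[X] ⧸ Ideal.span {(X : k[X]) ^ s}) :=
  ((Submodule.mkQ _ ∘ₗ lcoeff k[X] 0).prod (Submodule.mkQ _ ∘ₗ lcoeff k[X] 1)) ∘ₗ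
    modByMonicHom (twoRowQuadratic k m c)

variable {k r s m c}

theorem twoRowMap_eq_zero_iff {p : k[X][X]} : twoRowMap k r s m c p = 0 ↔
    X ^ r ∣ (p %ₘ twoRowQuadratic k m c).coeff 0 ∧
    X ^ s ∣ (p %ₘ twoRowQuadratic k m c).coeff 1 := by
  rw [← Ideal.mem_span_singleton, ← Ideal.mem_span_singleton, ← Ideal.Quotient.eq_zero_iff_mem,
    ← Ideal.Quotient.eq_zero_iff_mem]
  exact Prod.ext_iff

theorem twoRow_mul_X_modByMonic (a b : k[X]) (q : k[X][X]) :
    (q * twoRowQuadratic k m c + C a + C b * X) %ₘ twoRowQuadratic k m c = C a + C b * X := by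
  rw [add_assoc, add_modByMonic, (modByMonic_eq_zero_iff_dvd (monic_twoRowQuadratic k m c)).2
    (Dvd.intro_left _ rfl), zero_add, modByMonic_eq_self_iff (monic_twoRowQuadratic k m c),
    degree_twoRowQuadratic, add_comm]
  exact degree_linear_lt

theorem twoRowMap_surjective : Function.Surjective (twoRowMap k r s m c) := by
  rintro ⟨a, b⟩
  obtain ⟨a, rfl⟩ := Ideal.Quotient.mk_surjective a
  obtain ⟨b, rfl⟩ := Ideal.Quotient.mk_surjective b
  refine ⟨C a + C b * X, ?_⟩
  have h := twoRow_mul_X_modByMonic (m := m) (c := c) a b 0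
  rw [zero_mul, zero_add] at h
  refine Prod.ext ?_ ?_
  · change Ideal.Quotient.mk _ (((C a + C b * X) %ₘ twoRowQuadratic k m c).coeff 0) = _
    rw [h]; simp
  · change Ideal.Quotient.mk _ (((C a + C b * X) %ₘ twoRowQuadratic k m c).coeff 1) = _
    rw [h]; simp

/-- The bounds ensure that multiplying generators by `x` imposes nothing new: `x y ^ r` is a
multiple of `x y ^ s` by `hs`, and `x (x y ^ s)` reduces to `-c y ^ (m + s)`, a multiple of `y ^ r`
by `hr`. -/
theorem twoRowMap_eq_zero_iff_mem (hs : s ≤ r) (hr : r ≤ m + s) {p : k[X][X]} :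
    twoRowMap k r s m c p = 0 ↔ p ∈ twoRowIdeal k r s m c (X : k[X][X]) (C X) := by
  have hq : (X : k[X][X]) ^ 2 + algebraMap k k[X][X] c * (C X) ^ m = twoRowQuadratic k m c := by
    rw [twoRowQuadratic, C_mul, C_pow]; rfl
  rw [mem_twoRowIdeal, hq]
  constructor
  · intro h
    obtain ⟨⟨a, ha⟩, ⟨b, hb⟩⟩ := twoRowMap_eq_zero_iff.1 h
    refine ⟨C a, C b, p /ₘ twoRowQuadratic k m c, ?_⟩
    conv_lhs => rw [← modByMonic_add_div p (twoRowQuadratic k m c), twoRow_modByMonic, ha, hb]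
    simp only [C_mul, C_pow]
    ring
  · rintro ⟨a, b, d, rfl⟩
    have key : ∀ a : k[X][X], ∃ (α β : k[X]) (q : k[X][X]),
        a = q * twoRowQuadratic k m c + C α + C β * X := fun a =>
      ⟨(a %ₘ twoRowQuadratic k m c).coeff 0, (a %ₘ twoRowQuadratic k m c).coeff 1,
        a /ₘ twoRowQuadratic k m c, by
        conv_lhs => rw [← modByMonic_add_div a (twoRowQuadratic k m c), twoRow_modByMonic]
        ring⟩
    obtain ⟨α, β, q, rfl⟩ := key a
    obtain ⟨α', β', q', rfl⟩ := key b
    obtain ⟨t, rfl⟩ := Nat.exists_eq_add_of_le hs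
    obtain ⟨w, hw⟩ := Nat.exists_eq_add_of_le hr
    have e : (q * twoRowQuadratic k m c + C α + C β * X) * C X ^ (s + t) +
        (q' * twoRowQuadratic k m c + C α' + C β' * X) * (X * C X ^ s) +
        d * twoRowQuadratic k m c =
        (q * C X ^ (s + t) + q' * X * C X ^ s + d + C (β' * X ^ s)) * twoRowQuadratic k m c +
        C (X ^ (s + t) * (α - C c * β' * X ^ w)) + C (X ^ s * (β * X ^ t + α')) * X := by
      have h2 : (C X : k[X][X]) ^ m * C X ^ s = C X ^ (s + t) * C X ^ w := by
        rw [← pow_add, ← pow_add, hw]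
      rw [twoRowQuadratic]
      simp only [C_mul, C_add, C_sub, C_pow]
      linear_combination (-C β' * C (C c)) * h2
    have hc : ∀ a b : k[X], (C a + C b * X).coeff 0 = a ∧ (C a + C b * X).coeff 1 = b :=
      fun a b => by simp
    rw [twoRowMap_eq_zero_iff, e, twoRow_mul_X_modByMonic, (hc _ _).1, (hc _ _).2]
    exact ⟨Dvd.intro _ rfl, Dvd.intro _ rfl⟩

theorem nonempty_twoRow_equiv (hs : s ≤ r) (hr : r ≤ m + s) :
    Nonempty ((k[X][X] ⧸ twoRowIdeal k r s m c (X : k[X][X]) (C X)) ≃ₗ[k] (Fin (r + s) → k)) := by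
  have hker : ((twoRowIdeal k r s m c (X : k[X][X]) (C X)).restrictScalars k) =
      LinearMap.ker ((twoRowMap k r s m c).restrictScalars k) := by
    ext p
    exact (twoRowMap_eq_zero_iff_mem hs hr).symm
  have : ∀ n : ℕ, Module.Finite k (k[X] ⧸ Ideal.span {(X : k[X]) ^ n}) := fun n =>
    (monic_X_pow n).finite_quotient
  have h : ∀ n : ℕ, Module.finrank k (k[X] ⧸ Ideal.span {(X : k[X]) ^ n}) = n := fun n => by
    rw [finrank_quotient_span_eq_natDegree, natDegree_X_pow]
  exact ⟨(Submodule.Quotient.restrictScalarsEquiv k _).symm ≪≫ₗ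
    Submodule.quotEquivOfEq _ _ hker ≪≫ₗ
    ((twoRowMap k r s m c).restrictScalars k).quotKerEquivOfSurjective twoRowMap_surjective ≪≫ₗ
    LinearEquiv.ofFinrankEq _ _ (by rw [Module.finrank_prod, h, h, Module.finrank_fin_fun])⟩

open MvPolynomial in
theorem nonempty_twoRow_equiv_mvPolynomial (hs : s ≤ r) (hr : r ≤ m + s) {i j : Fin 2}
    (hij : i ≠ j) :
    Nonempty ((MvPolynomial (Fin 2) k ⧸ twoRowIdeal k r s m c (MvPolynomial.X i)
      (MvPolynomial.X j : MvPolynomial (Fin 2) k)) ≃ₗ[k] (Fin (r + s) → k)) := by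
  let F : MvPolynomial (Fin 2) k →ₐ[k] k[X][X] :=
    aeval fun l => if l = i then (Polynomial.X : k[X][X]) else Polynomial.C Polynomial.X
  let G₀ : k[X] →ₐ[k] MvPolynomial (Fin 2) k := Polynomial.aeval (MvPolynomial.X j)
  let G : k[X][X] →+* MvPolynomial (Fin 2) k :=
    Polynomial.eval₂RingHom G₀.toRingHom (MvPolynomial.X i)
  have hl : ∀ l, l = i ∨ l = j := fun l => by omega
  have hFi : F (MvPolynomial.X i) = Polynomial.X := by simp [F]
  have hFj : F (MvPolynomial.X j) = Polynomial.C Polynomial.X := by simp [F, hij.symm]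
  have hGX : G Polynomial.X = MvPolynomial.X i := by simp [G]
  have hGC : ∀ p, G (Polynomial.C p) = G₀ p := fun p => by simp [G]
  have hGF : G.comp F.toRingHom = RingHom.id _ := by
    refine MvPolynomial.ringHom_ext (fun a => ?_) fun l => ?_
    · have : F (MvPolynomial.C a) = Polynomial.C (Polynomial.C a) := F.commutes a
      simp [this, hGC]
      exact G₀.commutes a
    · rcases hl l with rfl | rfl
      · simp [hFi, hGX]
      · simp [hFj, hGC, G₀]
  have hFG : F.toRingHom.comp G = RingHom.id _ := by
    refine Polynomial.ringHom_ext' (Polynomial.ringHom_ext (fun a => ?_) ?_) ?_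
    · have : F (MvPolynomial.C a) = Polynomial.C (Polynomial.C a) := F.commutes a
      simp [hGC, G₀, this]
    · simp [hGC, G₀, hFj]
    · simp [hGX, hFi]
  let e : MvPolynomial (Fin 2) k ≃ₐ[k] k[X][X] := AlgEquiv.ofBijective F
    ⟨Function.LeftInverse.injective (g := G) fun p => RingHom.congr_fun hGF p,
      Function.RightInverse.surjective (g := G) fun p => RingHom.congr_fun hFG p⟩
  obtain ⟨φ⟩ := nonempty_twoRow_equiv (c := c) hs hr
  refine ⟨(Ideal.quotientEquivAlg _ _ e ?_).toLinearEquiv ≪≫ₗ φ⟩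
  have he : ∀ p, (e : MvPolynomial (Fin 2) k →+* k[X][X]) p = F p := fun _ => rfl
  rw [twoRowIdeal, twoRowIdeal, Ideal.map_span]
  simp only [Set.image_insert_eq, Set.image_singleton, he, map_add, map_mul, map_pow, hFi, hFj,
    AlgHom.commutes]

end TwoRowAlgebra

/-! ### Verification for the normal forms. -/

namespace Hochschild

open MvPolynomial

theorem isRelPrime_X_zero_X_one {k : Type*} [Field k] :
    IsRelPrime (X 0 : MvPolynomial (Fin 2) k) (X 1) :=
  (X_prime.irreducible.isRelPrime_iff_not_dvd).2 (by simp [X_dvd_X])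

theorem isRelPrime_C_mul {k σ : Type*} [Field k] {c : k} (hc : c ≠ 0) {a b : MvPolynomial σ k} :
    IsRelPrime (C c * a) b ↔ IsRelPrime a b :=
  isRelPrime_mul_unit_left_left ((isUnit_iff_ne_zero.2 hc).map C)

/-- In a relation `a p = b q` with `p`, `q` coprime, `q` divides `a`, and cancelling `q` determines
`b`. -/
theorem isolatedEuler_of_isRelPrime {k : Type*} [Field k] {f e₁ e₂ p q : MvPolynomial (Fin 2) k}
    (hp : pderiv 0 f = p) (hq : pderiv 1 f = q) (hf : f ≠ 0) (he : f = e₁ * p + e₂ * q)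
    (hq0 : q ≠ 0) (h : IsRelPrime p q) : IsolatedEuler f e₁ e₂ where
  ne_zero := hf
  euler := by rw [hp, hq, ← he]
  rel a b hab := by
    rw [hp, hq] at *
    obtain ⟨c, rfl⟩ := h.symm.dvd_of_dvd_mul_right (Dvd.intro_left b hab.symm)
    refine ⟨c, mul_comm _ _, mul_right_cancel₀ hq0 ?_⟩
    rw [← hab]; ring

theorem nonempty_jacobian_equiv {k : Type*} [Field k] {f p q : MvPolynomial (Fin 2) k}
    (hp : pderiv 0 f = p) (hq : pderiv 1 f = q) {r s m : ℕ} (c : k) {i j : Fin 2} (hij : i ≠ j)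
    (hs : s ≤ r) (hr : r ≤ m + s)
    (h1 : ∃ a b d, p = a * X j ^ r + b * (X i * X j ^ s) +
      d * (X i ^ 2 + algebraMap k (MvPolynomial (Fin 2) k) c * X j ^ m))
    (h2 : ∃ a b d, q = a * X j ^ r + b * (X i * X j ^ s) +
      d * (X i ^ 2 + algebraMap k (MvPolynomial (Fin 2) k) c * X j ^ m))
    (h3 : ∃ a b, a * p + b * q = X j ^ r) (h4 : ∃ a b, a * p + b * q = X i * X j ^ s)
    (h5 : ∃ a b, a * p + b * q = X i ^ 2 + algebraMap k (MvPolynomial (Fin 2) k) c * X j ^ m) :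
    Nonempty ((MvPolynomial (Fin 2) k ⧸ jacobianIdeal f) ≃ₗ[k] (Fin (r + s) → k)) := by
  have h : jacobianIdeal f = twoRowIdeal k r s m c (X i) (X j) := by
    rw [jacobianIdeal, hp, hq]
    refine le_antisymm ?_ ?_
    · rw [Ideal.span_le, Set.insert_subset_iff, Set.singleton_subset_iff]
      exact ⟨(mem_twoRowIdeal ..).2 h1, (mem_twoRowIdeal ..).2 h2⟩
    · rw [twoRowIdeal, Ideal.span_le, Set.insert_subset_iff, Set.insert_subset_iff,
        Set.singleton_subset_iff]
      exact ⟨Ideal.mem_span_pair.2 h3, Ideal.mem_span_pair.2 h4, Ideal.mem_span_pair.2 h5⟩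
  rw [h]
  exact nonempty_twoRow_equiv_mvPolynomial hs hr hij

theorem C_inv_mul_C {k σ : Type*} [Field k] {c : k} (hc : c ≠ 0) :
    C c⁻¹ * C c = (1 : MvPolynomial σ k) := by
  rw [← C_mul, inv_mul_cancel₀ hc, C_1]

theorem ne_zero_of_eval_one {k σ : Type*} [Field k] {g : MvPolynomial σ k}
    (h : eval (fun _ => 1) g ≠ 0) : g ≠ 0 := by
  rintro rfl
  exact h (map_zero _)

end Hochschild

namespace SimpleType

open MvPolynomial Hochschild

/-- The hypotheses of the computation of Hochschild (co)homology of a plane curve whose Jacobian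
algebra has dimension `n`. -/
def Spec (f : MvPolynomial (Fin 2) ℂ) (n : ℕ) : Prop :=
  (∃ e₁ e₂, IsolatedEuler f e₁ e₂) ∧
    Nonempty ((MvPolynomial (Fin 2) ℂ ⧸ jacobianIdeal f) ≃ₗ[ℂ] (Fin n → ℂ))

theorem spec_A (n : ℕ) : Spec (X 0 ^ (n + 1) + X 1 ^ 2) n := by
  have hp : pderiv 0 (X 0 ^ (n + 1) + X 1 ^ 2 : MvPolynomial (Fin 2) ℂ) =
      C ((n : ℂ) + 1) * X 0 ^ n := by
    simp [Derivation.leibniz_pow, pderiv_X]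
  have hq : pderiv 1 (X 0 ^ (n + 1) + X 1 ^ 2 : MvPolynomial (Fin 2) ℂ) = C 2 * X 1 := by
    simp [map_ofNat C 2, Derivation.leibniz_pow, pderiv_X, nsmul_eq_mul]
  have hn : (n : ℂ) + 1 ≠ 0 := Nat.cast_add_one_ne_zero n
  have c1 := C_inv_mul_C (σ := Fin 2) hn
  have c2 := C_inv_mul_C (σ := Fin 2) (two_ne_zero (α := ℂ))
  -- The coefficients are the weights making `f` quasi-homogeneous of degree 1; the same holds for
  -- the other types.
  refine ⟨⟨C ((n : ℂ) + 1)⁻¹ * X 0, C 2⁻¹ * X 1, isolatedEuler_of_isRelPrime hp hq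
    (ne_zero_of_eval_one (by norm_num)) ?_ (ne_zero_of_eval_one (by norm_num)) ?_⟩, ?_⟩
  · linear_combination -X 0 ^ (n + 1) * c1 - X 1 ^ 2 * c2
  · rw [isRelPrime_C_mul hn, isRelPrime_comm, isRelPrime_C_mul two_ne_zero]
    exact isRelPrime_X_zero_X_one.symm.pow_right
  -- With `s = 0` the second row is empty: `X 1` itself lies in the ideal and its square is
  -- redundant. The value `m = n` only serves the bound `r ≤ m + s`.
  · refine nonempty_jacobian_equiv hp hq (r := n) (s := 0) (m := n) 0 (i := 1) (j := 0)
      (by decide) (by omega) (by omega) ⟨C ((n : ℂ) + 1), 0, 0, by ring⟩ ⟨0, C 2, 0, by ring⟩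
      ⟨C ((n : ℂ) + 1)⁻¹, 0, ?_⟩ ⟨0, C 2⁻¹, ?_⟩ ⟨0, C 2⁻¹ * X 1, ?_⟩
    · linear_combination X 0 ^ n * c1
    · linear_combination X 1 * c2
    · rw [map_zero]; linear_combination X 1 ^ 2 * c2

theorem spec_D (n : ℕ) : Spec (X 0 ^ 2 * X 1 + X 1 ^ (n + 3)) (n + 4) := by
  have hp : pderiv 0 (X 0 ^ 2 * X 1 + X 1 ^ (n + 3) : MvPolynomial (Fin 2) ℂ) =
      C 2 * (X 0 * X 1) := by
    simp [map_ofNat C 2, Derivation.leibniz_pow, pderiv_X]; ring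
  have hq : pderiv 1 (X 0 ^ 2 * X 1 + X 1 ^ (n + 3) : MvPolynomial (Fin 2) ℂ) =
      X 0 ^ 2 + C ((n : ℂ) + 3) * X 1 ^ (n + 2) := by
    simp [map_ofNat C 3, Derivation.leibniz_pow, pderiv_X]
  have hn : (n : ℂ) + 3 ≠ 0 := by exact_mod_cast (Nat.succ_ne_zero (n + 2))
  have hn' : (n : ℂ) + 4 ≠ 0 := by exact_mod_cast (Nat.succ_ne_zero (n + 3))
  have c1 := C_inv_mul_C (σ := Fin 2) hn
  have c2 := C_inv_mul_C (σ := Fin 2) (two_ne_zero (α := ℂ))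
  refine ⟨⟨C 2⁻¹ * (1 - C ((n : ℂ) + 3)⁻¹) * X 0, C ((n : ℂ) + 3)⁻¹ * X 1,
    isolatedEuler_of_isRelPrime hp hq
    (ne_zero_of_eval_one (by norm_num)) ?_ (ne_zero_of_eval_one ?_) ?_⟩, ?_⟩
  · linear_combination -X 0 ^ 2 * X 1 * (1 - C ((n : ℂ) + 3)⁻¹) * c2 - X 1 ^ (n + 3) * c1
  -- The value of the second partial derivative at `(1, 1)` is `1 + (n + 3) = n + 4`.
  · intro h
    refine hn' ?_
    simp at h
    linear_combination h
  · rw [isRelPrime_C_mul two_ne_zero]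
    refine IsRelPrime.mul_left ?_ ?_
    · have h : IsRelPrime (X 0 : MvPolynomial (Fin 2) ℂ) (C ((n : ℂ) + 3) * X 1 ^ (n + 2)) :=
        ((isRelPrime_C_mul hn).2 isRelPrime_X_zero_X_one.symm.pow_left).symm
      have := h.add_mul_left_right (X 0)
      rwa [add_comm, ← sq] at this
    · have h : IsRelPrime (X 1 : MvPolynomial (Fin 2) ℂ) (X 0 ^ 2) :=
        isRelPrime_X_zero_X_one.symm.pow_right
      have := h.add_mul_left_right (C ((n : ℂ) + 3) * X 1 ^ (n + 1))
      have e : (X 0 ^ 2 + X 1 * (C ((n : ℂ) + 3) * X 1 ^ (n + 1)) : MvPolynomial (Fin 2) ℂ) =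
          X 0 ^ 2 + C ((n : ℂ) + 3) * X 1 ^ (n + 2) := by ring
      rwa [e] at this
  · refine nonempty_jacobian_equiv hp hq (r := n + 3) (s := 1) (m := n + 2) ((n : ℂ) + 3) (i := 0)
      (j := 1) (by decide) (by omega) (by omega) ⟨0, C 2, 0, by ring⟩
      ⟨0, 0, 1, by rw [algebraMap_eq]; ring⟩
      -- `X 1 ^ (n + 3)` arises by eliminating `X 0 ^ 2 * X 1` between `X 1 * q` and `X 0 * p`.
      ⟨-(C ((n : ℂ) + 3)⁻¹ * C 2⁻¹ * X 0), C ((n : ℂ) + 3)⁻¹ * X 1, ?_⟩ ⟨C 2⁻¹, 0, ?_⟩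
      ⟨0, 1, by rw [algebraMap_eq]; ring⟩
    · linear_combination -C ((n : ℂ) + 3)⁻¹ * X 0 ^ 2 * X 1 * c2 + X 1 ^ (n + 3) * c1
    · linear_combination X 0 * X 1 * c2

/-- The singularities `x ^ 3 + y ^ (n + 1)`. -/
theorem spec_E (n : ℕ) : Spec (X 0 ^ 3 + X 1 ^ (n + 1)) (n + n) := by
  have hp : pderiv 0 (X 0 ^ 3 + X 1 ^ (n + 1) : MvPolynomial (Fin 2) ℂ) = C 3 * X 0 ^ 2 := by
    simp [map_ofNat C 3, Derivation.leibniz_pow, pderiv_X, nsmul_eq_mul]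
  have hq : pderiv 1 (X 0 ^ 3 + X 1 ^ (n + 1) : MvPolynomial (Fin 2) ℂ) =
      C ((n : ℂ) + 1) * X 1 ^ n := by
    simp [Derivation.leibniz_pow, pderiv_X]
  have hn : (n : ℂ) + 1 ≠ 0 := Nat.cast_add_one_ne_zero n
  have c1 := C_inv_mul_C (σ := Fin 2) hn
  have c2 := C_inv_mul_C (σ := Fin 2) (three_ne_zero (α := ℂ))
  refine ⟨⟨C 3⁻¹ * X 0, C ((n : ℂ) + 1)⁻¹ * X 1, isolatedEuler_of_isRelPrime hp hq
    (ne_zero_of_eval_one (by norm_num)) ?_ (ne_zero_of_eval_one (by simpa using hn)) ?_⟩, ?_⟩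
  · linear_combination -X 0 ^ 3 * c2 - X 1 ^ (n + 1) * c1
  · rw [isRelPrime_C_mul three_ne_zero, isRelPrime_comm, isRelPrime_C_mul hn]
    exact isRelPrime_X_zero_X_one.symm.pow
  -- Two rows of equal length; the generator `X 0 * X 1 ^ n` is redundant.
  · refine nonempty_jacobian_equiv hp hq (r := n) (s := n) (m := 0) 0 (i := 0) (j := 1)
      (by decide) (by omega) (by omega) ⟨0, 0, C 3, by rw [map_zero]; ring⟩
      ⟨C ((n : ℂ) + 1), 0, 0, by ring⟩
      ⟨0, C ((n : ℂ) + 1)⁻¹, ?_⟩ ⟨0, C ((n : ℂ) + 1)⁻¹ * X 0, ?_⟩ ⟨C 3⁻¹, 0, ?_⟩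
    · linear_combination X 1 ^ n * c1
    · linear_combination X 0 * X 1 ^ n * c1
    · rw [map_zero]; linear_combination X 0 ^ 2 * c2

theorem spec_E7 : Spec (X 0 ^ 3 + X 0 * X 1 ^ 3) 7 := by
  have hp : pderiv 0 (X 0 ^ 3 + X 0 * X 1 ^ 3 : MvPolynomial (Fin 2) ℂ) =
      C 3 * X 0 ^ 2 + X 1 ^ 3 := by
    simp [map_ofNat C 3, Derivation.leibniz_pow, pderiv_X, nsmul_eq_mul]
  have hq : pderiv 1 (X 0 ^ 3 + X 0 * X 1 ^ 3 : MvPolynomial (Fin 2) ℂ) =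
      C 3 * (X 0 * X 1 ^ 2) := by
    simp [map_ofNat C 3, Derivation.leibniz_pow, pderiv_X, nsmul_eq_mul]; ring
  have c3 := C_inv_mul_C (σ := Fin 2) (three_ne_zero (α := ℂ))
  refine ⟨⟨C 3⁻¹ * X 0, C 3⁻¹ * (1 - C 3⁻¹) * X 1, isolatedEuler_of_isRelPrime hp hq
    (ne_zero_of_eval_one (by norm_num)) ?_ (ne_zero_of_eval_one (by norm_num)) ?_⟩, ?_⟩
  · linear_combination (-X 0 ^ 3 - (1 - C 3⁻¹) * X 0 * X 1 ^ 3) * c3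
  · rw [isRelPrime_comm, isRelPrime_C_mul three_ne_zero]
    refine IsRelPrime.mul_left ?_ (IsRelPrime.pow_left ?_)
    · have h : IsRelPrime (X 0 : MvPolynomial (Fin 2) ℂ) (X 1 ^ 3) :=
        isRelPrime_X_zero_X_one.pow_right
      have := h.add_mul_left_right (C 3 * X 0)
      have e : (X 1 ^ 3 + X 0 * (C 3 * X 0) : MvPolynomial (Fin 2) ℂ) =
          C 3 * X 0 ^ 2 + X 1 ^ 3 := by ring
      rwa [e] at this
    · have h : IsRelPrime (X 1 : MvPolynomial (Fin 2) ℂ) (C 3 * X 0 ^ 2) :=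
        ((isRelPrime_C_mul three_ne_zero).2 isRelPrime_X_zero_X_one.pow_left).symm
      have := h.add_mul_left_right (X 1 ^ 2)
      have e : (C 3 * X 0 ^ 2 + X 1 * X 1 ^ 2 : MvPolynomial (Fin 2) ℂ) =
          C 3 * X 0 ^ 2 + X 1 ^ 3 := by ring
      rwa [e] at this
  · refine nonempty_jacobian_equiv hp hq (r := 5) (s := 2) (m := 3) (3⁻¹ : ℂ) (i := 0)
      (j := 1) (by decide) (by omega) (by omega)
      ⟨0, 0, C 3, by rw [algebraMap_eq]; linear_combination -X 1 ^ 3 * c3⟩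
      ⟨0, C 3, 0, by ring⟩
      -- `y² (3x² + y³) - x (3xy²) = y⁵` explains `r = 5`.
      ⟨X 1 ^ 2, -X 0, by ring⟩ ⟨0, C 3⁻¹, ?_⟩ ⟨C 3⁻¹, 0, ?_⟩
    · linear_combination X 0 * X 1 ^ 2 * c3
    · rw [algebraMap_eq]; linear_combination X 0 ^ 2 * c3

theorem spec_normalForm (T : SimpleType) : Spec T.normalForm T.index := by
  cases T with
  | A k hk => exact spec_A k
  | D k hk =>
    -- With `k = n + 4` the truncated exponent `k - 1` becomes `n + 3`.
    obtain ⟨n, rfl⟩ := Nat.exists_eq_add_of_le' hk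
    exact spec_D n
  | E6 => exact spec_E 3
  | E7 => exact spec_E7
  | E8 => exact spec_E 4

end SimpleType

theorem mainTheorem1 (T : SimpleType) :
    Nonempty (Hochschild.Cohomology ℂ T.CoordRing 0 ≃ₗ[T.CoordRing] T.CoordRing) ∧
    Nonempty (Hochschild.Homology ℂ T.CoordRing 0 ≃ₗ[T.CoordRing] T.CoordRing) ∧
    (∃ e : (T.CoordRing × (Fin T.index → ℂ)) ≃ₗ[ℂ] Hochschild.Cohomology ℂ T.CoordRing 1,
      ∀ a b : T.CoordRing, e (a * b, 0) = a • e (b, 0)) ∧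
    Nonempty (Hochschild.Homology ℂ T.CoordRing 1 ≃ₗ[T.CoordRing]
      ((Fin 2 → T.CoordRing) ⧸ Submodule.span T.CoordRing {T.gradient})) ∧
    ∀ j : ℕ, 2 ≤ j →
      Nonempty (Hochschild.Cohomology ℂ T.CoordRing j ≃ₗ[ℂ] (Fin T.index → ℂ)) ∧
      Nonempty (Hochschild.Homology ℂ T.CoordRing j ≃ₗ[ℂ] (Fin T.index → ℂ)) := by
  obtain ⟨⟨e₁, e₂, H⟩, ⟨φ⟩⟩ := T.spec_normalForm
  refine ⟨Hochschild.cohomology_zero_curve H.ne_zero, Hochschild.homology_zero_curve H.ne_zero,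
    Hochschild.cohomology_one_curve H φ, Hochschild.homology_one_curve H.ne_zero, fun j hj => ?_⟩
  obtain ⟨n, rfl⟩ := Nat.exists_eq_add_of_le' hj
  exact ⟨Hochschild.cohomology_curve H φ n, Hochschild.homology_curve H φ n⟩
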